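/- **Setting.** Let $\mathbb B=\{x\in\mathbb R^4:|x|<1\}$ carry the hyperbolic metric $g_h=\frac{4|dx|^2}{(1-|x|^2)^2}$ and the standard orientation. Let $\sigma(x)=\left(\frac{2x}{1-|x|^2},\frac{1+|x|^2}{1-|x|^2}\right)$ be the stereographic projection of $\mathbb B$ onto the hyperboloid $\{x\circ x=-1,\ x_5>0\}$ in the Lorentz space $\mathbb R^{4,1}$, where $x\circ y=x_1y_1+\dots+x_4y_4-x_5y_5$. A *hyperbolic 2-plane* in $\mathbb B$ is a set $\Lambda=\{x\in\mathbb B:\sigma(x)\in W\}$, where $W\subset\mathbb R^{4,1}$ is a $3$-dimensional vector subspace containing a vector $w$ with $w\circ w<0$. (These are exactly the sets $\Lambda(b,V)$, where $V\subset\mathbb R^4$ is a $2$-dimensional vector subspace, $b\in\mathbb B$ is orthogonal to $V$, and $\Lambda(b,V)$ is the unique hyperbolic 2-plane with $b\in\Lambda(b,V)$, $T_b\Lambda(b,V)=V$ and $|b|=\min\{|x|:x\in\Lambda(b,V)\}$.) For a smooth embedded oriented surface $M\subset\mathbb B$, $x\in M$ and a normal vector $n\in N_x$, let $S_x(n):T_xM\to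 T_xM$ be the second fundamental form in the direction $n$, taken with respect to $g_h$; the normal plane $N_x$ is cooriented. $M$ is *totally geodesic* if $S_x(n)=0$ for all $x$ and $n$. $M$ is *superminimal of positive (negative) spin* if for every $x\in M$ and every unit vector $v\in T_xM$ the curve $I_x(v)=\{S_x(n)v:n\in N_x,\ |n|=1\}$ is a circle in $T_xM$ centred at $0$, possibly reduced to the point $0$, and the map $n\mapsto S_x(n)v$ is orientation preserving (respectively reversing) whenever this circle is not reduced to $0$. Let $\Omega=\{[z_1:z_2:z_3:z_4]\in\mathbb{CP}^3:|z_1|^2+|z_2|^2>|z_3|^2+|z_4|^2\}$. Put $q_1=z_1+z_2\mathbf j$ and $q_2=z_3+z_4\mathbf j$ in $\mathbb H=\mathbb R^4$, and let $\pi:\Omega\to\mathbb B$, $\pi([z])=q_1^{-1}q_2$, be the twistor projection. The point $[z]\in\Omega$ represents the almost hermitian structure $J_{[z]}$ on $T_{\pi([z])}\mathbb R^4=\mathbb H$ for which $d\pi_{[z]}$ is complex linear, namely $J_{[z]}h=q_1^{-1}\mathbf i\,q_1h$. The *twistor lift* to $\Omega$ of an oriented surface $M\subset\mathbb B$ assigns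 to $x\in M$ the point of $\pi^{-1}(x)$ whose almost hermitian structure restricts to the rotation of the oriented plane $T_xM$ by $+\pi/2$. Let $\xi=\ker\beta$, where $\beta=z_1dz_2-z_2dz_1-z_3dz_4+z_4dz_3$. **Proposition.** Every hyperbolic 2-plane $\Lambda\subset\mathbb B$ is a smooth embedded orientable totally geodesic surface in $(\mathbb B,g_h)$. With either orientation, 1. $\Lambda$ is a superminimal surface both of positive and of negative spin; 2. the twistor lift of $\Lambda$ to $\Omega$ is well defined (its image is mapped bijectively onto $\Lambda$ by $\pi$), and its image is $\Omega\cap\mathbb P(L)$ for a $2$-dimensional complex vector subspace $L\subset\mathbb C^4$ such that the linear rational curve $\mathbb P(L)\cong\mathbb{CP}^1\subset\mathbb{CP}^3$ is $\xi$-Legendrian, i.e. tangent to $\xi$. -/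

import Mathlib

open scoped ContDiff LinearAlgebra.Projectivization

noncomputable section

/-- Euclidean `ℝ⁴`. -/
abbrev E4 : Type := EuclideanSpace ℝ (Fin 4)

/-- Euclidean `ℝ²`, the parameter space of surfaces. -/
abbrev E2 : Type := EuclideanSpace ℝ (Fin 2)

/-- The open unit ball of `ℝ⁴`. -/
def unitBall4 : Set E4 := {x | ‖x‖ < 1}

/-! ### The hyperbolic metric and its Levi-Civita connection -/

/-- The hyperbolic metric `4|dx|² / (1-|x|²)²` at `x`, as a bilinear form. -/
def gh (x u v : E4) : ℝ := 4 / (1 - ‖x‖ ^ 2) ^ 2 * inner ℝ u v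

/-- The standard basis of `ℝ⁴`. -/
def stdVec (k : Fin 4) : E4 := EuclideanSpace.single k 1

/-- The Christoffel map of the Levi-Civita connection of `gh` in the global coordinates of the
ball: the `k`-th component of `christoffel x u v` is
`½ g^{kk} (∂_u g(v, e_k) + ∂_v g(u, e_k) - ∂_k g(u, v))`, with `g^{kl} = (1-|x|²)²/4 δ^{kl}`
the inverse of the metric.  Thus `∇_u Y = DY(u) + christoffel x u Y`. -/
def christoffel (x u v : E4) : E4 :=
  ∑ k : Fin 4, ((1 - ‖x‖ ^ 2) ^ 2 / 4 * (1 / 2 *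
    (fderiv ℝ (fun y => gh y v (stdVec k)) x u + fderiv ℝ (fun y => gh y u (stdVec k)) x v
      - fderiv ℝ (fun y => gh y u v) x (stdVec k)))) • stdVec k

/-! ### Hyperbolic planes in the ball -/

/-- The Lorentz inner product `x ∘ y` on `ℝ^{4,1} = ℝ⁴ × ℝ`. -/
def lorentz (x y : E4 × ℝ) : ℝ := inner ℝ x.1 y.1 - x.2 * y.2

/-- The stereographic projection of the ball onto the hyperboloid `x ∘ x = -1, x₅ > 0`. -/
def hypStereo (x : E4) : E4 × ℝ :=
  ((2 / (1 - ‖x‖ ^ 2)) • x, (1 + ‖x‖ ^ 2) / (1 - ‖x‖ ^ 2))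

/-- A hyperbolic `m`-plane of the ball: the preimage under stereographic projection of the
intersection of the hyperboloid with an `(m+1)`-dimensional time-like vector subspace of
`ℝ^{4,1}`. -/
def IsHyperbolicPlane (m : ℕ) (P : Set E4) : Prop :=
  ∃ W : Submodule ℝ (E4 × ℝ), Module.finrank ℝ W = m + 1 ∧ (∃ w ∈ W, lorentz w w < 0) ∧
    P = {x | x ∈ unitBall4 ∧ hypStereo x ∈ W}

/-! ### Surfaces in the ball -/

/-- `f : U → M` is a smooth regular parametrization of a relatively open part of `M`: an injective
smooth immersion that is open as a map into `M`. -/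
structure IsLocalParam (M : Set E4) (U : Set E2) (f : E2 → E4) : Prop where
  isOpen : IsOpen U
  smooth : ContDiffOn ℝ ∞ f U
  mapsTo : Set.MapsTo f U M
  injOn : Set.InjOn f U
  immersion : ∀ p ∈ U, Function.Injective (fderiv ℝ f p)
  relOpen : ∀ O ⊆ U, IsOpen O → ∃ O' : Set E4, IsOpen O' ∧ f '' O = M ∩ O'

/-- A smooth embedded surface in the ball. -/
def IsEmbeddedSurface (M : Set E4) : Prop :=
  M ⊆ unitBall4 ∧ ∀ x ∈ M, ∃ (U : Set E2) (f : E2 → E4), IsLocalParam M U f ∧ x ∈ f '' U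

/-- The tangent space of `M` at `x`: velocities of curves in `M` through `x` (for an embedded
surface these already form a vector space). -/
def tangentPlane (M : Set E4) (x : E4) : Submodule ℝ E4 :=
  Submodule.span ℝ {v | ∃ γ : ℝ → E4, (∀ᶠ t in nhds 0, γ t ∈ M) ∧ γ 0 = x ∧ HasDerivAt γ v 0}

/-- `n` is normal to `M` at `x` with respect to the hyperbolic metric. -/
def IsNormal (M : Set E4) (x n : E4) : Prop := ∀ v ∈ tangentPlane M x, gh x n v = 0

/-- An orientation of the surface `M`, given by a continuous 2-form along `M` that does not vanish
on the tangent planes.  A basis `(u, v)` of `T_x M` is positive when `0 < θ x ![u, v]`. -/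
def IsOrientation (M : Set E4) (θ : E4 → E4 [⋀^Fin 2]→L[ℝ] ℝ) : Prop :=
  ContinuousOn θ M ∧ ∀ x ∈ M, ∀ u ∈ tangentPlane M x, ∀ v ∈ tangentPlane M x,
    LinearIndependent ℝ ![u, v] → θ x ![u, v] ≠ 0

/-- The ambient covariant derivative `∇_a (df c)` of the coordinate field `df c` along a
parametrization `f`. Its normal component is the second fundamental form. -/
def covHess (f : E2 → E4) (p a c : E2) : E4 :=
  fderiv ℝ (fun q => fderiv ℝ f q c) p a + christoffel (f p) (fderiv ℝ f p a) (fderiv ℝ f p c)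

/-- `M` is totally geodesic: its second fundamental form vanishes in every normal direction. -/
def IsTotallyGeodesic (M : Set E4) : Prop :=
  ∀ (U : Set E2) (f : E2 → E4), IsLocalParam M U f → ∀ p ∈ U, ∀ n, IsNormal M (f p) n →
    ∀ a c : E2, gh (f p) n (covHess f p a c) = 0

/-- `s = S_x(n) v`, where `S_x(n) : T_x M → T_x M` is the second fundamental form in the normal
direction `n`: `s ∈ T_x M`, and `g(s, w) = g(n, II(v, w))` for all `w ∈ T_x M`. -/
def IsShapeValue (M : Set E4) (x n v s : E4) : Prop :=
  s ∈ tangentPlane M x ∧ ∃ (U : Set E2) (f : E2 → E4) (p a : E2), IsLocalParam M U f ∧ p ∈ U ∧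
    f p = x ∧ fderiv ℝ f p a = v ∧
    ∀ c : E2, gh x s (fderiv ℝ f p c) = gh x n (covHess f p a c)

/-- The curve `I_x(v) = {S_x(n) v : n ∈ N_x, |n| = 1}`. -/
def indicatrix (M : Set E4) (x v : E4) : Set E4 :=
  {s | ∃ n, IsNormal M x n ∧ gh x n n = 1 ∧ IsShapeValue M x n v s}

/-- `(n₁, n₂)` is a positive basis of the cooriented normal plane `N_x`: it completes positive
bases of `T_x M` to positive bases of `ℝ⁴`. -/
def IsPosNormalPair (M : Set E4) (θ : E4 → E4 [⋀^Fin 2]→L[ℝ] ℝ) (x n₁ n₂ : E4) : Prop :=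
  IsNormal M x n₁ ∧ IsNormal M x n₂ ∧
    ∀ u ∈ tangentPlane M x, ∀ v ∈ tangentPlane M x, 0 < θ x ![u, v] →
      0 < Matrix.det (Matrix.of ![⇑u, ⇑v, ⇑n₁, ⇑n₂])

/-- The surface `M`, oriented by `θ`, is superminimal of positive (`ε = 1`) or negative (`ε = -1`)
spin: for every unit tangent vector `v` at `x`, the curve `I_x(v)` is a circle of some radius
`r ≥ 0` centred at `0` in `T_x M`, and if `r > 0` then the (linear) map `n ↦ S_x(n) v` from `N_x`
to `T_x M` preserves (resp. reverses) orientation. -/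
def IsSuperminimal (ε : ℤˣ) (M : Set E4) (θ : E4 → E4 [⋀^Fin 2]→L[ℝ] ℝ) : Prop :=
  ∀ x ∈ M, ∀ v ∈ tangentPlane M x, gh x v v = 1 →
    ∃ r : ℝ, 0 ≤ r ∧ indicatrix M x v = {s | s ∈ tangentPlane M x ∧ gh x s s = r ^ 2} ∧
      (0 < r → ∀ n₁ n₂ s₁ s₂, IsPosNormalPair M θ x n₁ n₂ →
        IsShapeValue M x n₁ v s₁ → IsShapeValue M x n₂ v s₂ →
        0 < ((ε : ℤ) : ℝ) * θ x ![s₁, s₂])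

/-! ### The twistor space -/

/-- `ℂ⁴` with coordinates `(z₁, z₂, z₃, z₄) = (z 0, z 1, z 2, z 3)`. -/
abbrev C4 : Type := Fin 4 → ℂ

/-- The quaternion `z + w 𝐣 = x₁ + x₂ 𝐢 + x₃ 𝐣 + x₄ 𝐤` for `z = x₁ + x₂ i`, `w = x₃ + x₄ i`. -/
def quatOfPair (z w : ℂ) : Quaternion ℝ := ⟨z.re, z.im, w.re, w.im⟩

/-- The quaternionic unit `𝐢`. -/
def quatI : Quaternion ℝ := ⟨0, 1, 0, 0⟩

/-- The identification of `ℍ` with `ℝ⁴` in the basis `1, 𝐢, 𝐣, 𝐤`. -/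
abbrev quatR4 : Quaternion ℝ ≃ₗᵢ[ℝ] E4 := Quaternion.linearIsometryEquivTuple

/-- The twistor projection `(q₁, q₂) ↦ q₁⁻¹ q₂` in homogeneous coordinates, where
`q₁ = z₁ + z₂ 𝐣` and `q₂ = z₃ + z₄ 𝐣` (used where `q₁ ≠ 0`). -/
def twistorVec (z : C4) : E4 :=
  quatR4 ((quatOfPair (z 0) (z 1))⁻¹ * quatOfPair (z 2) (z 3))

/-- The almost hermitian structure `J` on `T_x ℝ⁴ = ℝ⁴ = ℍ`, `x = twistorVec z`, which is
represented by the point `[z]` of the twistor space: left multiplication by the imaginary unit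
quaternion `q₁⁻¹ 𝐢 q₁`.  It is the structure for which the differential of the twistor projection
is complex linear at `z`; see `fderiv_twistorVec_I_smul`. -/
def twistorStructure (z : C4) (h : E4) : E4 :=
  quatR4 ((quatOfPair (z 0) (z 1))⁻¹ * quatI * quatOfPair (z 0) (z 1) * quatR4.symm h)

/-- The domain `Ω ⊂ ℂℙ³`. -/
def twistorDomain : Set (ℙ ℂ C4) :=
  {ℓ | ‖ℓ.rep 2‖ ^ 2 + ‖ℓ.rep 3‖ ^ 2 < ‖ℓ.rep 0‖ ^ 2 + ‖ℓ.rep 1‖ ^ 2}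

/-- The twistor projection on `ℂℙ³` (with values in the unit ball on `Ω`). -/
def twistorProj (ℓ : ℙ ℂ C4) : E4 := twistorVec ℓ.rep

/-- The almost hermitian structure on `T_{π(ℓ)} ℝ⁴` represented by `ℓ`. -/
def twistorJ (ℓ : ℙ ℂ C4) : E4 → E4 := twistorStructure ℓ.rep

/-- The (image of the) twistor lift to `Ω` of the surface `M` oriented by `θ`: the points of `Ω`
over `x ∈ M` whose almost hermitian structure `J` on `T_x ℝ⁴` restricts to the positive rotation by
a right angle on the oriented plane `T_x M`. (Since `J` is orthogonal and agrees with the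
orientation of `ℝ⁴`, it then also is the positive rotation on the cooriented normal plane.) -/
def twistorLift (M : Set E4) (θ : E4 → E4 [⋀^Fin 2]→L[ℝ] ℝ) : Set (ℙ ℂ C4) :=
  {ℓ | ℓ ∈ twistorDomain ∧ twistorProj ℓ ∈ M ∧ ∀ u ∈ tangentPlane M (twistorProj ℓ),
    twistorJ ℓ u ∈ tangentPlane M (twistorProj ℓ) ∧
      (u ≠ 0 → 0 < θ (twistorProj ℓ) ![u, twistorJ ℓ u])}

/-- The contact form `β = z₁dz₂ - z₂dz₁ - z₃dz₄ + z₄dz₃` at the point `z` on the vector `v`. -/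
def contactForm (z v : C4) : ℂ := z 0 * v 1 - z 1 * v 0 - z 2 * v 3 + z 3 * v 2

/-- The linear rational curve in `ℂℙ³` defined by a complex vector subspace `L` of `ℂ⁴`. -/
def projLine (L : Submodule ℂ C4) : Set (ℙ ℂ C4) := {ℓ | ℓ.submodule ≤ L}

/-- The linear curve defined by `L` is tangent to the contact bundle `ξ = ker β`: at each of its
points `[z]` the tangent vectors, represented by `v ∈ L`, are annihilated by `β`. -/
def IsLegendrianSubspace (L : Submodule ℂ C4) : Prop := ∀ z ∈ L, ∀ v ∈ L, contactForm z v = 0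

/-! ### Consistency of the twistor definitions -/

theorem quatOfPair_re (z w : ℂ) : (quatOfPair z w).re = z.re := rfl
theorem quatOfPair_imI (z w : ℂ) : (quatOfPair z w).imI = z.im := rfl
theorem quatOfPair_imJ (z w : ℂ) : (quatOfPair z w).imJ = w.re := rfl
theorem quatOfPair_imK (z w : ℂ) : (quatOfPair z w).imK = w.im := rfl

theorem quatI_eq : quatI = quatOfPair Complex.I 0 := by
  ext <;> simp [quatOfPair, quatI]

theorem quatOfPair_smul (c z w : ℂ) :
    quatOfPair (c * z) (c * w) = quatOfPair c 0 * quatOfPair z w := by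
  ext <;> simp [quatOfPair_re, quatOfPair_imI, quatOfPair_imJ, quatOfPair_imK]

theorem quatOfPair_ne_zero {c : ℂ} (hc : c ≠ 0) : quatOfPair c 0 ≠ 0 := by
  intro h
  exact hc (Complex.ext (congrArg (fun q : Quaternion ℝ => q.re) h)
    (congrArg (fun q : Quaternion ℝ => q.imI) h))

theorem quatI_comm (c : ℂ) : quatI * quatOfPair c 0 = quatOfPair c 0 * quatI := by
  rw [quatI_eq]
  ext <;> simp [quatOfPair_re, quatOfPair_imI, quatOfPair_imJ, quatOfPair_imK]

theorem quatI_mul_quatI : quatI * quatI = -1 := by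
  rw [quatI_eq]
  ext <;> simp [quatOfPair_re, quatOfPair_imI, quatOfPair_imJ, quatOfPair_imK] <;> rfl

/-- The twistor projection does not depend on the choice of homogeneous coordinates. -/
theorem twistorVec_smul (c : ℂ) (hc : c ≠ 0) (z : C4) : twistorVec (c • z) = twistorVec z := by
  simp only [twistorVec, Pi.smul_apply, smul_eq_mul, quatOfPair_smul, mul_inv_rev]
  rw [mul_assoc, inv_mul_cancel_left₀ (quatOfPair_ne_zero hc)]

/-- The almost hermitian structure does not depend on the choice of homogeneous coordinates. -/
theorem twistorStructure_smul (c : ℂ) (hc : c ≠ 0) (z : C4) :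
    twistorStructure (c • z) = twistorStructure z := by
  funext h
  simp only [twistorStructure, Pi.smul_apply, smul_eq_mul, quatOfPair_smul, mul_inv_rev]
  have e : ∀ a b : Quaternion ℝ, a * (quatOfPair c 0)⁻¹ * quatI * (quatOfPair c 0 * b)
      = a * quatI * b := by
    intro a b
    rw [mul_assoc _ quatI, ← mul_assoc quatI, quatI_comm]
    simp only [mul_assoc]
    rw [inv_mul_cancel_left₀ (quatOfPair_ne_zero hc)]
  rw [e]

/-- The structure `J` represented by `[z]` satisfies `J² = -1`. -/
theorem twistorStructure_sq (z : C4) (hz : quatOfPair (z 0) (z 1) ≠ 0) (h : E4) :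
    twistorStructure z (twistorStructure z h) = -h := by
  simp only [twistorStructure, LinearIsometryEquiv.symm_apply_apply, mul_assoc]
  rw [mul_inv_cancel_left₀ hz, ← mul_assoc quatI quatI, quatI_mul_quatI,
    neg_one_mul, mul_neg, inv_mul_cancel_left₀ hz, map_neg, LinearIsometryEquiv.apply_symm_apply]

/-- The structure `J` represented by `[z]` is an isometry. -/
theorem norm_twistorStructure (z : C4) (hz : quatOfPair (z 0) (z 1) ≠ 0) (h : E4) :
    ‖twistorStructure z h‖ = ‖h‖ := by
  have hi : ‖quatI‖ = 1 := by
    have h1 : ‖quatI‖ * ‖quatI‖ = 1 := by rw [← norm_mul, quatI_mul_quatI, norm_neg, norm_one]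
    nlinarith [norm_nonneg quatI]
  simp only [twistorStructure, LinearIsometryEquiv.norm_map, norm_mul, norm_inv, hi, mul_one]
  rw [inv_mul_cancel₀ (norm_ne_zero_iff.2 hz), one_mul]

/-- The real linear map `z ↦ z_i + z_j 𝐣`. -/
def quatCoord (i j : Fin 4) : C4 →ₗ[ℝ] Quaternion ℝ where
  toFun z := quatOfPair (z i) (z j)
  map_add' z w := by
    ext <;> simp [quatOfPair_re, quatOfPair_imI, quatOfPair_imJ, quatOfPair_imK]
  map_smul' r z := by
    ext <;> simp [quatOfPair_re, quatOfPair_imI, quatOfPair_imJ, quatOfPair_imK]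

/-- The differential of the twistor projection intertwines multiplication by `i` with the
structure `J` represented by `[z]`. -/
theorem fderiv_twistorVec_I_smul (z : C4) (hz : quatOfPair (z 0) (z 1) ≠ 0) (v : C4) :
    fderiv ℝ twistorVec z (Complex.I • v) = twistorStructure z (fderiv ℝ twistorVec z v) := by
  set A : C4 →L[ℝ] Quaternion ℝ := LinearMap.toContinuousLinearMap (quatCoord 0 1) with hA
  set B : C4 →L[ℝ] Quaternion ℝ := LinearMap.toContinuousLinearMap (quatCoord 2 3) with hB
  have hz' : A z ≠ 0 := hz
  have h1 : HasFDerivAt (fun y => (A y)⁻¹ * B y) _ z :=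
    ((hasFDerivAt_inv' hz').comp z A.hasFDerivAt).mul' B.hasFDerivAt
  have h2 := (quatR4.toContinuousLinearEquiv.toContinuousLinearMap.hasFDerivAt).comp z h1
  have h3 : ∀ w, fderiv ℝ twistorVec z w
      = quatR4 ((A z)⁻¹ * B w + -((A z)⁻¹ * A w * (A z)⁻¹) * B z) := by
    intro w
    have h4 : HasFDerivAt twistorVec _ z := h2
    rw [h4.fderiv]
    rfl
  have e : ∀ i j : Fin 4, quatOfPair ((Complex.I • v) i) ((Complex.I • v) j)
      = quatI * quatOfPair (v i) (v j) := fun i j => quatOfPair_smul _ _ _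
  have hAI : A (Complex.I • v) = quatI * A v := e 0 1
  have hBI : B (Complex.I • v) = quatI * B v := e 2 3
  rw [h3, h3, hAI, hBI]
  simp only [twistorStructure, LinearIsometryEquiv.symm_apply_apply]
  change _ = quatR4 ((A z)⁻¹ * quatI * A z * _)
  congr 1
  simp only [mul_add, mul_neg, neg_mul, mul_assoc]
  rw [mul_inv_cancel_left₀ hz', mul_inv_cancel_left₀ hz']

end

/-! The Lorentz complement of the time-like space `W` is positive definite. An orthonormal basis
`n₁, n₂` of it turns Λ into the set of `x` in the ball with `2⟨n.1, x⟩ = n.2 (1 + |x|²)` for both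
`n`. Half the gradient of such an equation is `ν(x) = n.1 - n.2 x`, and on Λ the two fields are
Euclidean orthonormal (`inner_conormal_conormal`). They frame the normal planes.

Differentiating the equations twice gives a term that the Christoffel term of the conformal metric
cancels exactly (`inner_conormal_covHess`). So Λ is totally geodesic, every `S_x(n)` is zero, and
both spin conditions hold with circles of radius 0.

For the twistor lift, `u = ν₂ ν̄₁` is an imaginary unit quaternion. Left multiplication by it
carries `ν₁` to `ν₂` and hence rotates the tangent plane by a right angle. Λ is connected, so an
orientation agrees everywhere with `u` or everywhere with `-u` (`apply_leftMul_pos_or_neg`);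
exchanging `n₁` and `n₂` exchanges the two cases. The lift therefore consists of the `[z]` over Λ
with `q₁⁻¹ 𝐢 q₁ = u`, exactly one over each point.

Since `q₂ = q₁ x`, the condition `𝐢 q₁ ν₁ = q₁ ν₂` is complex linear in `z`. Together with a
companion equation it says `𝐢 c(n₁) z = c(n₂) z` for the Clifford action `c` of Lorentz vectors on
`ℍ²`, and the companion forces `x ∈ Λ` (`IsLorentzPair.mem_twistorSubspace_iff`). This defines `L`.
Unit space-like vectors reverse the sign of the quaternionic hermitian form `H`, so on `L` the
values of `H` commute with `𝐢`. Their `𝐣`-part, which is `-β`, vanishes, and `L` is Legendrian.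
Isotropy bounds its dimension by 2, and the lifts of two distinct points of Λ span it. -/

noncomputable section

/-! ### Lorentz linear algebra -/

/-- The Lorentz inner product as a bilinear form. -/
def lorentzForm : LinearMap.BilinForm ℝ (E4 × ℝ) :=
  LinearMap.mk₂ ℝ lorentz
    (fun x y z => by simp only [lorentz, Prod.fst_add, Prod.snd_add, inner_add_left]; ring)
    (fun c x y => by
      simp only [lorentz, Prod.smul_fst, Prod.smul_snd, real_inner_smul_left, smul_eq_mul]; ring)
    (fun x y z => by simp only [lorentz, Prod.fst_add, Prod.snd_add, inner_add_right]; ring)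
    (fun c x y => by
      simp only [lorentz, Prod.smul_fst, Prod.smul_snd, real_inner_smul_right, smul_eq_mul]; ring)

theorem lorentzForm_apply (x y : E4 × ℝ) : lorentzForm x y = lorentz x y := rfl

theorem lorentz_comm (x y : E4 × ℝ) : lorentz x y = lorentz y x := by
  simp only [lorentz, real_inner_comm, mul_comm]

theorem lorentz_add_left (x y z : E4 × ℝ) : lorentz (x + y) z = lorentz x z + lorentz y z := by
  simp [← lorentzForm_apply]

theorem lorentz_add_right (x y z : E4 × ℝ) : lorentz x (y + z) = lorentz x y + lorentz x z := by
  simp [← lorentzForm_apply]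

theorem lorentz_smul_left (c : ℝ) (x y : E4 × ℝ) : lorentz (c • x) y = c * lorentz x y := by
  simp [← lorentzForm_apply]

theorem lorentz_smul_right (c : ℝ) (x y : E4 × ℝ) : lorentz x (c • y) = c * lorentz x y := by
  simp [← lorentzForm_apply]

theorem lorentzForm_isRefl : lorentzForm.IsRefl := fun x y h => by
  rw [lorentzForm_apply, lorentz_comm]; exact h

theorem lorentzForm_nondegenerate : lorentzForm.Nondegenerate := by
  refine (LinearMap.IsRefl.nondegenerate_iff_separatingLeft lorentzForm_isRefl).2 fun x hx => ?_
  -- Pairing with the time reflection of `x` yields the Euclidean square `|x.1|² + x.2²`.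
  have h := hx (x.1, -x.2)
  simp only [lorentzForm_apply, lorentz, real_inner_self_eq_norm_sq] at h
  have h1 : ‖x.1‖ = 0 := by nlinarith [sq_nonneg ‖x.1‖, sq_nonneg x.2]
  have h2 : x.2 = 0 := by nlinarith [sq_nonneg ‖x.1‖, sq_nonneg x.2]
  exact Prod.ext (norm_eq_zero.1 h1) h2

/-- Orthogonality reads `⟨w.1, x.1⟩ = w.2 x.2`; Cauchy–Schwarz together with `|w.1| < |w.2|` then
forces `|x.2| < |x.1|`. -/
theorem lorentz_pos_of_orthogonal {w x : E4 × ℝ} (hw : lorentz w w < 0) (h : lorentz w x = 0)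
    (hx : x ≠ 0) : 0 < lorentz x x := by
  simp only [lorentz, real_inner_self_eq_norm_sq] at *
  have hcs := abs_real_inner_le_norm w.1 x.1
  have hsq : (inner ℝ w.1 x.1) ^ 2 ≤ ‖w.1‖ ^ 2 * ‖x.1‖ ^ 2 := by
    rw [← mul_pow, ← sq_abs]; gcongr
  rw [show inner ℝ w.1 x.1 = w.2 * x.2 by linarith] at hsq
  have hw2 : 0 < w.2 * w.2 := by nlinarith [sq_nonneg ‖w.1‖]
  by_cases h0 : x.1 = 0
  · have : x.2 = 0 := by
      rw [h0, norm_zero] at hsq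
      have : w.2 * x.2 = 0 := by nlinarith [sq_nonneg (w.2 * x.2)]
      rcases mul_eq_zero.1 this with h | h
      · rw [h] at hw2; simp at hw2
      · exact h
    exact absurd (Prod.ext h0 this) hx
  · have hp : 0 < ‖x.1‖ ^ 2 := by have := norm_pos_iff.2 h0; positivity
    by_contra hneg
    nlinarith

/-- Gram–Schmidt for a plane on which the Lorentz form is positive definite. -/
theorem exists_lorentz_orthonormal_pair (S : Submodule ℝ (E4 × ℝ)) (hS : Module.finrank ℝ S = 2)
    (hpos : ∀ x ∈ S, x ≠ 0 → 0 < lorentz x x) :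
    ∃ e₁ ∈ S, ∃ e₂ ∈ S, lorentz e₁ e₁ = 1 ∧ lorentz e₂ e₂ = 1 ∧ lorentz e₁ e₂ = 0 := by
  obtain ⟨e, he⟩ : ∃ e : S × S, LinearIndependent ℝ ![e.1, e.2] := by
    let b := Module.finBasisOfFinrankEq ℝ S hS
    refine ⟨(b 0, b 1), ?_⟩
    have hb : ![b 0, b 1] = b := by funext i; fin_cases i <;> rfl
    simpa only [hb] using b.linearIndependent
  have hnorm : ∀ x ∈ S, x ≠ 0 → ∃ c : ℝ, c ≠ 0 ∧ lorentz (c • x) (c • x) = 1 := fun x hx h0 => by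
    have hp := hpos x hx h0
    refine ⟨(√(lorentz x x))⁻¹, by positivity, ?_⟩
    rw [lorentz_smul_left, lorentz_smul_right, ← mul_assoc, ← mul_inv, Real.mul_self_sqrt hp.le,
      inv_mul_cancel₀ hp.ne']
  rw [LinearIndependent.pair_iff] at he
  have h1 : (e.1 : E4 × ℝ) ≠ 0 := fun h => by
    simpa using he 1 0 (by simpa using h)
  obtain ⟨c, hc, hc1⟩ := hnorm e.1 e.1.2 h1
  set a : E4 × ℝ := c • (e.1 : E4 × ℝ) with ha
  have haS : a ∈ S := S.smul_mem _ e.1.2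
  set d : E4 × ℝ := (e.2 : E4 × ℝ) - lorentz a e.2 • a with hd
  have hdS : d ∈ S := S.sub_mem e.2.2 (S.smul_mem _ haS)
  have hd0 : d ≠ 0 := fun h => by
    have := he (-(lorentz a e.2 * c)) 1 (by
      apply Subtype.ext
      rw [← ZeroMemClass.coe_zero S] at h
      simp only [Submodule.coe_add, Submodule.coe_smul, ZeroMemClass.coe_zero] at h ⊢
      rw [← h, hd, ha]
      module)
    simp at this
  obtain ⟨c', hc', hc1'⟩ := hnorm d hdS hd0
  refine ⟨a, haS, c' • d, S.smul_mem _ hdS, hc1, hc1', ?_⟩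
  rw [lorentz_smul_right, hd, sub_eq_add_neg, lorentz_add_right, ← neg_smul, lorentz_smul_right,
    hc1]
  ring

/-- A Lorentz orthonormal basis of a time-like space of dimension three (`w₀` future directed and
time-like) together with a Lorentz orthonormal basis `n₁, n₂` of its orthogonal complement. -/
structure IsLorentzFrame (w₀ w₁ w₂ n₁ n₂ : E4 × ℝ) : Prop where
  future : 0 < w₀.2
  w₀₀ : lorentz w₀ w₀ = -1
  w₁₁ : lorentz w₁ w₁ = 1
  w₂₂ : lorentz w₂ w₂ = 1
  w₀₁ : lorentz w₀ w₁ = 0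
  w₀₂ : lorentz w₀ w₂ = 0
  w₁₂ : lorentz w₁ w₂ = 0
  n₁₁ : lorentz n₁ n₁ = 1
  n₂₂ : lorentz n₂ n₂ = 1
  n₁₂ : lorentz n₁ n₂ = 0
  orthogonal_iff : ∀ y, lorentz n₁ y = 0 ∧ lorentz n₂ y = 0 ↔
    y = (-lorentz w₀ y) • w₀ + lorentz w₁ y • w₁ + lorentz w₂ y • w₂

theorem finrank_lorentz : Module.finrank ℝ (E4 × ℝ) = 5 := by simp

/-- The complement of `w₀` in `W` and the complement of `W` are both orthogonal to a time-like
vector, hence positive definite planes to which Gram–Schmidt applies. Nondegeneracy gives `W =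
W^⊥⊥`, which turns membership into two equations. -/
theorem exists_isLorentzFrame (W : Submodule ℝ (E4 × ℝ)) (hW : Module.finrank ℝ W = 3)
    (ht : ∃ w ∈ W, lorentz w w < 0) :
    ∃ w₀ w₁ w₂ n₁ n₂, IsLorentzFrame w₀ w₁ w₂ n₁ n₂ ∧
      ∀ y, y ∈ W ↔ lorentz n₁ y = 0 ∧ lorentz n₂ y = 0 := by
  obtain ⟨w₀, hw₀, h₀₀, hf⟩ : ∃ w ∈ W, lorentz w w = -1 ∧ 0 < w.2 := by
    obtain ⟨w, hw, hn⟩ := ht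
    have hw2 : w.2 ≠ 0 := fun h => by
      simp only [lorentz, h, real_inner_self_eq_norm_sq] at hn
      nlinarith [sq_nonneg ‖w.1‖]
    obtain ⟨c, hc0, hc⟩ : ∃ c : ℝ, 0 < c ∧ c * (c * lorentz w w) = -1 := by
      have hp : 0 < -lorentz w w := by linarith
      refine ⟨(√(-lorentz w w))⁻¹, by positivity, ?_⟩
      rw [← mul_assoc, ← mul_inv, Real.mul_self_sqrt hp.le]
      rw [inv_mul_eq_div, div_neg, div_self (by linarith)]
    rcases lt_or_gt_of_ne hw2 with h | h
    · refine ⟨(-c) • w, W.smul_mem _ hw, ?_, ?_⟩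
      · rw [lorentz_smul_left, lorentz_smul_right]; linarith
      · simp only [Prod.smul_snd, smul_eq_mul]; nlinarith
    · refine ⟨c • w, W.smul_mem _ hw, ?_, ?_⟩
      · rw [lorentz_smul_left, lorentz_smul_right]; linarith
      · simp only [Prod.smul_snd, smul_eq_mul]; positivity
  have hneg : lorentz w₀ w₀ < 0 := by linarith
  -- the orthogonal complement of `w₀` in `W`
  let φ : W →ₗ[ℝ] ℝ := (lorentzForm w₀).comp W.subtype
  have hφ : LinearMap.range φ = ⊤ := by
    refine LinearMap.range_eq_top.2 fun r => ⟨(-r) • ⟨w₀, hw₀⟩, ?_⟩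
    change lorentz w₀ ((-r) • w₀) = r
    rw [lorentz_smul_right, h₀₀]; ring
  have hker : Module.finrank ℝ (LinearMap.ker φ) = 2 := by
    have := φ.finrank_range_add_finrank_ker
    rw [hφ, hW, finrank_top, Module.finrank_self] at this
    omega
  obtain ⟨w₁, h₁, w₂, h₂, h₁₁, h₂₂, h₁₂⟩ := exists_lorentz_orthonormal_pair
    ((LinearMap.ker φ).map W.subtype)
    (by rw [Submodule.finrank_map_subtype_eq, hker])
    (by
      rintro _ ⟨x, hx, rfl⟩ h0
      exact lorentz_pos_of_orthogonal hneg hx h0)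
  have hmem : ∀ w ∈ (LinearMap.ker φ).map W.subtype, w ∈ W ∧ lorentz w₀ w = 0 := by
    rintro _ ⟨x, hx, rfl⟩
    exact ⟨x.2, hx⟩
  obtain ⟨hw₁, h₀₁⟩ := hmem _ h₁
  obtain ⟨hw₂, h₀₂⟩ := hmem _ h₂
  have hperp : Module.finrank ℝ (lorentzForm.orthogonal W) = 2 := by
    rw [LinearMap.BilinForm.finrank_orthogonal lorentzForm_nondegenerate, finrank_lorentz, hW]
  obtain ⟨n₁, hn₁, n₂, hn₂, hn₁₁, hn₂₂, hn₁₂⟩ := exists_lorentz_orthonormal_pair _ hperp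
    fun x hx h0 => lorentz_pos_of_orthogonal hneg (hx w₀ hw₀) h0
  have hpair : LinearIndependent ℝ ![n₁, n₂] := by
    refine LinearIndependent.pair_iff.2 fun s t hst => ?_
    have e1 := congrArg (lorentz n₁) hst
    have e2 := congrArg (lorentz n₂) hst
    -- Zero is written as a multiple of `n₁` so that the bilinearity lemmas evaluate both sides.
    rw [← zero_smul ℝ n₁] at e1 e2
    simp only [lorentz_add_right, lorentz_smul_right, hn₁₁, hn₁₂, hn₂₂, lorentz_comm n₂ n₁] at e1 e2
    constructor <;> linarith
  have hspan : Submodule.span ℝ (Set.range ![n₁, n₂]) = lorentzForm.orthogonal W := by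
    refine Submodule.eq_of_le_of_finrank_le (Submodule.span_le.2 ?_) ?_
    · rintro _ ⟨i, rfl⟩
      fin_cases i
      exacts [hn₁, hn₂]
    · rw [hperp, finrank_span_eq_card hpair]; simp
  have hiff : ∀ y, y ∈ W ↔ lorentz n₁ y = 0 ∧ lorentz n₂ y = 0 := fun y => by
    conv_lhs => rw [← LinearMap.BilinForm.orthogonal_orthogonal lorentzForm_nondegenerate
      lorentzForm_isRefl W]
    rw [LinearMap.BilinForm.mem_orthogonal_iff, ← hspan]
    constructor
    · intro h
      exact ⟨h n₁ (Submodule.subset_span ⟨0, rfl⟩), h n₂ (Submodule.subset_span ⟨1, rfl⟩)⟩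
    · rintro ⟨ha, hb⟩ n hn
      change lorentz n y = 0
      induction hn using Submodule.span_induction with
      | mem x hx =>
        obtain ⟨i, rfl⟩ := hx
        fin_cases i
        exacts [ha, hb]
      | zero => simp [lorentz]
      | add x y _ _ hx hy => rw [lorentz_add_left, hx, hy, add_zero]
      | smul c x _ hx => rw [lorentz_smul_left, hx, mul_zero]
  have htriple : LinearIndependent ℝ ![w₀, w₁, w₂] := by
    rw [Fintype.linearIndependent_iff]
    intro g hg
    have hg' : g 0 • w₀ + g 1 • w₁ + g 2 • w₂ = (0 : ℝ) • w₀ := by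
      simpa [Fin.sum_univ_three] using hg
    have e0 := congrArg (lorentz w₀) hg'
    have e1 := congrArg (lorentz w₁) hg'
    have e2 := congrArg (lorentz w₂) hg'
    simp only [lorentz_add_right, lorentz_smul_right, h₀₀, h₁₁, h₂₂, h₀₁, h₀₂, h₁₂,
      lorentz_comm w₁ w₀, lorentz_comm w₂ w₀, lorentz_comm w₂ w₁] at e0 e1 e2
    intro i
    fin_cases i <;> simp <;> linarith
  have hspanW : Submodule.span ℝ (Set.range ![w₀, w₁, w₂]) = W := by
    refine Submodule.eq_of_le_of_finrank_le (Submodule.span_le.2 ?_) ?_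
    · rintro _ ⟨i, rfl⟩
      fin_cases i
      exacts [hw₀, hw₁, hw₂]
    · rw [hW, finrank_span_eq_card htriple]; simp
  refine ⟨w₀, w₁, w₂, n₁, n₂, ⟨hf, h₀₀, h₁₁, h₂₂, h₀₁, h₀₂, h₁₂, hn₁₁, hn₂₂, hn₁₂, fun y => ?_⟩,
    hiff⟩
  rw [← hiff]
  constructor
  · intro hy
    rw [← hspanW, Submodule.mem_span_range_iff_exists_fun] at hy
    obtain ⟨c, rfl⟩ := hy
    simp only [Fin.sum_univ_three, Matrix.cons_val]
    simp only [lorentz_add_right, lorentz_smul_right, h₀₀, h₁₁, h₂₂, h₀₁, h₀₂, h₁₂,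
      lorentz_comm w₁ w₀, lorentz_comm w₂ w₀, lorentz_comm w₂ w₁]
    module
  · intro hy
    rw [hy]
    exact W.add_mem (W.add_mem (W.smul_mem _ hw₀) (W.smul_mem _ hw₁)) (W.smul_mem _ hw₂)

/-! ### The hyperboloid model -/

/-- For time-like vectors the product of the time components dominates the spatial inner product, so
it alone decides the sign. This selects the sheet of the hyperboloid. -/
theorem lorentz_neg_iff_of_timelike {w y : E4 × ℝ} (hw : lorentz w w < 0) (hf : 0 < w.2)
    (hy : lorentz y y < 0) : lorentz w y < 0 ↔ 0 < y.2 := by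
  simp only [lorentz, real_inner_self_eq_norm_sq] at *
  have hcs := abs_le.1 (abs_real_inner_le_norm w.1 y.1)
  have h1 : ‖w.1‖ < w.2 := by nlinarith [norm_nonneg w.1]
  have h2 : ‖y.1‖ < |y.2| := by
    rw [← abs_norm]; exact sq_lt_sq.1 (by linarith)
  have h3 : ‖w.1‖ * ‖y.1‖ ≤ w.2 * ‖y.1‖ := by gcongr
  have h4 : w.2 * ‖y.1‖ < w.2 * |y.2| := by gcongr
  constructor
  · intro h
    by_contra hn
    rw [abs_of_nonpos (not_lt.1 hn)] at h4
    linarith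
  · intro h
    rw [abs_of_pos h] at h4
    linarith

/-- The inverse of the stereographic projection. -/
def hypStereoInv (y : E4 × ℝ) : E4 := (1 + y.2)⁻¹ • y.1

theorem one_sub_norm_sq_pos {x : E4} (hx : x ∈ unitBall4) : 0 < 1 - ‖x‖ ^ 2 := by
  have : ‖x‖ < 1 := hx
  nlinarith [norm_nonneg x]

theorem lorentz_hypStereo {x : E4} (hx : x ∈ unitBall4) :
    lorentz (hypStereo x) (hypStereo x) = -1 := by
  have h := one_sub_norm_sq_pos hx
  simp only [lorentz, hypStereo, real_inner_smul_left, real_inner_smul_right]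
  rw [real_inner_self_eq_norm_sq]
  field_simp
  ring

theorem hypStereo_future {x : E4} (hx : x ∈ unitBall4) : 0 < (hypStereo x).2 := by
  have h := one_sub_norm_sq_pos hx
  simp only [hypStereo]
  positivity

theorem hypStereoInv_hypStereo {x : E4} (hx : x ∈ unitBall4) :
    hypStereoInv (hypStereo x) = x := by
  have h := one_sub_norm_sq_pos hx
  simp only [hypStereoInv, hypStereo, smul_smul]
  rw [show 1 + (1 + ‖x‖ ^ 2) / (1 - ‖x‖ ^ 2) = 2 / (1 - ‖x‖ ^ 2) by field_simp; ring,
    inv_mul_cancel₀ (by positivity), one_smul]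

theorem norm_sq_hypStereoInv {y : E4 × ℝ} (hy : lorentz y y = -1) (hf : 0 < y.2) :
    ‖hypStereoInv y‖ ^ 2 = (y.2 - 1) / (1 + y.2) := by
  simp only [lorentz, real_inner_self_eq_norm_sq] at hy
  rw [hypStereoInv, norm_smul, mul_pow, Real.norm_eq_abs, sq_abs]
  rw [show ‖y.1‖ ^ 2 = (y.2 - 1) * (1 + y.2) by linarith]
  field_simp

theorem hypStereoInv_mem {y : E4 × ℝ} (hy : lorentz y y = -1) (hf : 0 < y.2) :
    hypStereoInv y ∈ unitBall4 := by
  have h : ‖hypStereoInv y‖ ^ 2 < 1 := by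
    rw [norm_sq_hypStereoInv hy hf, div_lt_one (by linarith)]; linarith
  show ‖hypStereoInv y‖ < 1
  nlinarith [norm_nonneg (hypStereoInv y)]

theorem hypStereo_hypStereoInv {y : E4 × ℝ} (hy : lorentz y y = -1) (hf : 0 < y.2) :
    hypStereo (hypStereoInv y) = y := by
  have h := norm_sq_hypStereoInv hy hf
  have h1 : 1 - ‖hypStereoInv y‖ ^ 2 = 2 / (1 + y.2) := by rw [h]; field_simp; ring
  have h2 : 1 + ‖hypStereoInv y‖ ^ 2 = 2 * y.2 / (1 + y.2) := by rw [h]; field_simp; ring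
  refine Prod.ext ?_ ?_
  · simp only [hypStereo, h1]
    rw [hypStereoInv, smul_smul]
    convert one_smul ℝ y.1 using 2
    field_simp
  · simp only [hypStereo, h1, h2]
    field_simp

/-! ### Planes given by two equations -/

/-- The part of the ball cut out by the Lorentz orthogonal complement of `n₁, n₂`. -/
def conormalPlane (n₁ n₂ : E4 × ℝ) : Set E4 :=
  {x | x ∈ unitBall4 ∧ lorentz n₁ (hypStereo x) = 0 ∧ lorentz n₂ (hypStereo x) = 0}

/-- The normal vector at `x` to the hypersurface `n ∘ σ(x) = 0`. -/
def conormal (n : E4 × ℝ) (x : E4) : E4 := n.1 - n.2 • x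

/-- Clearing the denominator `1 - |x|²` leaves a polynomial equation that is easy to differentiate;
for space-like `n` it describes a hyperplane through 0 or a sphere orthogonal to the unit sphere. -/
theorem lorentz_hypStereo_eq_zero_iff {x : E4} (hx : x ∈ unitBall4) (n : E4 × ℝ) :
    lorentz n (hypStereo x) = 0 ↔ 2 * inner ℝ n.1 x = n.2 * (1 + ‖x‖ ^ 2) := by
  have h := one_sub_norm_sq_pos hx
  simp only [lorentz, hypStereo, real_inner_smul_right]
  rw [div_mul_eq_mul_div, mul_div_assoc', ← sub_div, div_eq_zero_iff, or_iff_left h.ne', sub_eq_zero]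

/-- The two equations replace the mixed terms by `-n.2 m.2 (1 + |x|²)`, and the `|x|²` contributions
cancel. Lorentz orthonormality thus becomes Euclidean orthonormality at every point of the plane. -/
theorem inner_conormal_conormal {x : E4} {n m : E4 × ℝ}
    (hn : 2 * inner ℝ n.1 x = n.2 * (1 + ‖x‖ ^ 2)) (hm : 2 * inner ℝ m.1 x = m.2 * (1 + ‖x‖ ^ 2)) :
    inner ℝ (conormal n x) (conormal m x) = lorentz n m := by
  simp only [conormal, lorentz, inner_sub_left, inner_sub_right, real_inner_smul_left,
    real_inner_smul_right, real_inner_self_eq_norm_sq, real_inner_comm m.1 x]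
  linear_combination (-m.2 / 2) * hn - n.2 / 2 * hm

/-- The vectors orthogonal to both conormals. -/
def conormalPerp (n₁ n₂ : E4 × ℝ) (x : E4) : Submodule ℝ E4 :=
  (Submodule.span ℝ (Set.range ![conormal n₁ x, conormal n₂ x]))ᗮ

theorem mem_conormalPerp {n₁ n₂ : E4 × ℝ} {x v : E4} : v ∈ conormalPerp n₁ n₂ x ↔
    inner ℝ (conormal n₁ x) v = 0 ∧ inner ℝ (conormal n₂ x) v = 0 := by
  rw [conormalPerp, Submodule.mem_orthogonal]
  constructor
  · intro h
    exact ⟨h _ (Submodule.subset_span ⟨0, rfl⟩), h _ (Submodule.subset_span ⟨1, rfl⟩)⟩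
  · rintro ⟨h₁, h₂⟩ u hu
    induction hu using Submodule.span_induction with
    | mem x hx =>
      obtain ⟨i, rfl⟩ := hx
      fin_cases i
      exacts [h₁, h₂]
    | zero => simp
    | add x y _ _ hx hy => rw [inner_add_left, hx, hy, add_zero]
    | smul c x _ hx => rw [real_inner_smul_left, hx, mul_zero]

/-- `n₁, n₂` are Lorentz orthonormal. -/
structure IsLorentzPair (n₁ n₂ : E4 × ℝ) : Prop where
  n₁₁ : lorentz n₁ n₁ = 1
  n₂₂ : lorentz n₂ n₂ = 1
  n₁₂ : lorentz n₁ n₂ = 0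

theorem IsLorentzPair.swap {n₁ n₂ : E4 × ℝ} (h : IsLorentzPair n₁ n₂) : IsLorentzPair n₂ n₁ :=
  ⟨h.n₂₂, h.n₁₁, by rw [lorentz_comm, h.n₁₂]⟩

theorem conormalPlane_swap (n₁ n₂ : E4 × ℝ) : conormalPlane n₁ n₂ = conormalPlane n₂ n₁ := by
  ext x; simp only [conormalPlane, Set.mem_ofPred_eq]; tauto

section LorentzPair

variable {n₁ n₂ : E4 × ℝ} {x : E4}

theorem conormalPlane_eq₁ (hx : x ∈ conormalPlane n₁ n₂) :
    2 * inner ℝ n₁.1 x = n₁.2 * (1 + ‖x‖ ^ 2) :=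
  (lorentz_hypStereo_eq_zero_iff hx.1 n₁).1 hx.2.1

theorem conormalPlane_eq₂ (hx : x ∈ conormalPlane n₁ n₂) :
    2 * inner ℝ n₂.1 x = n₂.2 * (1 + ‖x‖ ^ 2) :=
  (lorentz_hypStereo_eq_zero_iff hx.1 n₂).1 hx.2.2

theorem orthonormal_conormal (h : IsLorentzPair n₁ n₂) (hx : x ∈ conormalPlane n₁ n₂) :
    Orthonormal ℝ ![conormal n₁ x, conormal n₂ x] := by
  have h1 := conormalPlane_eq₁ hx
  have h2 := conormalPlane_eq₂ hx
  rw [orthonormal_iff_ite]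
  intro i j
  fin_cases i <;> fin_cases j
  · exact (inner_conormal_conormal h1 h1).trans h.n₁₁
  · exact (inner_conormal_conormal h1 h2).trans h.n₁₂
  · exact (inner_conormal_conormal h2 h1).trans ((lorentz_comm _ _).trans h.n₁₂)
  · exact (inner_conormal_conormal h2 h2).trans h.n₂₂

theorem norm_conormal₁ (h : IsLorentzPair n₁ n₂) (hx : x ∈ conormalPlane n₁ n₂) :
    ‖conormal n₁ x‖ = 1 := (orthonormal_conormal h hx).1 0

theorem norm_conormal₂ (h : IsLorentzPair n₁ n₂) (hx : x ∈ conormalPlane n₁ n₂) :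
    ‖conormal n₂ x‖ = 1 := (orthonormal_conormal h hx).1 1

theorem inner_conormal₁₂ (h : IsLorentzPair n₁ n₂) (hx : x ∈ conormalPlane n₁ n₂) :
    inner ℝ (conormal n₁ x) (conormal n₂ x) = 0 := by
  rw [inner_conormal_conormal (conormalPlane_eq₁ hx) (conormalPlane_eq₂ hx), h.n₁₂]

theorem finrank_span_conormal (h : IsLorentzPair n₁ n₂) (hx : x ∈ conormalPlane n₁ n₂) :
    Module.finrank ℝ (Submodule.span ℝ (Set.range ![conormal n₁ x, conormal n₂ x])) = 2 := by
  rw [finrank_span_eq_card (orthonormal_conormal h hx).linearIndependent]; simp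

theorem finrank_conormalPerp (h : IsLorentzPair n₁ n₂) (hx : x ∈ conormalPlane n₁ n₂) :
    Module.finrank ℝ (conormalPerp n₁ n₂ x) = 2 := by
  have := Submodule.finrank_add_finrank_orthogonal
    (Submodule.span ℝ (Set.range ![conormal n₁ x, conormal n₂ x]))
  rw [finrank_span_conormal h hx, finrank_euclideanSpace_fin] at this
  rw [conormalPerp]
  omega

/-- Differentiating the defining equations along a curve gives twice the pairing of its velocity
with the conormals. -/
theorem tangentPlane_le :
    tangentPlane (conormalPlane n₁ n₂) x ≤ conormalPerp n₁ n₂ x := by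
  refine Submodule.span_le.2 ?_
  rintro v ⟨γ, hγ, hγ0, hv⟩
  have key : ∀ n : E4 × ℝ, (∀ y ∈ conormalPlane n₁ n₂,
      2 * inner ℝ n.1 y = n.2 * (1 + ‖y‖ ^ 2)) → inner ℝ (conormal n x) v = 0 := by
    intro n hn
    have h1 : HasDerivAt (fun t => 2 * inner ℝ n.1 (γ t) - n.2 * (1 + ‖γ t‖ ^ 2))
        (2 * inner ℝ n.1 v - n.2 * (2 * inner ℝ x v)) 0 := by
      have ha := (((hasDerivAt_const (0 : ℝ) n.1).inner ℝ hv).const_mul 2)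
      have hb := ((hv.norm_sq).const_add 1).const_mul n.2
      rw [hγ0] at hb
      refine (ha.sub hb).congr_deriv ?_
      simp
    have h2 : (fun t => 2 * inner ℝ n.1 (γ t) - n.2 * (1 + ‖γ t‖ ^ 2)) =ᶠ[nhds 0] fun _ => 0 := by
      filter_upwards [hγ] with t ht
      rw [hn _ ht, sub_self]
    have h3 := (h1.congr_of_eventuallyEq h2.symm).unique (hasDerivAt_const (0 : ℝ) (0 : ℝ))
    rw [conormal, inner_sub_left, real_inner_smul_left]
    linarith
  exact mem_conormalPerp.2 ⟨key n₁ fun y hy => conormalPlane_eq₁ hy,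
    key n₂ fun y hy => conormalPlane_eq₂ hy⟩

theorem range_fderiv_le_tangentPlane {M : Set E4} {U : Set E2} {f : E2 → E4}
    (hf : IsLocalParam M U f) {p : E2} (hp : p ∈ U) :
    LinearMap.range (fderiv ℝ f p : E2 →ₗ[ℝ] E4) ≤ tangentPlane M (f p) := by
  rintro _ ⟨c, rfl⟩
  refine Submodule.subset_span ⟨fun t => f (p + t • c), ?_, by simp, ?_⟩
  · have hc : Continuous fun t : ℝ => p + t • c := by fun_prop
    have : ∀ᶠ t in nhds (0 : ℝ), p + t • c ∈ U :=
      hc.continuousAt.eventually_mem (hf.isOpen.mem_nhds (by simpa using hp))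
    exact this.mono fun t ht => hf.mapsTo ht
  · have hd : DifferentiableAt ℝ f p :=
      (hf.smooth.contDiffAt (hf.isOpen.mem_nhds hp)).differentiableAt (by simp)
    have hl : HasDerivAt (fun t : ℝ => p + t • c) c 0 := by
      simpa using ((hasDerivAt_id (0 : ℝ)).smul_const c).const_add p
    have hd' : HasFDerivAt f (fderiv ℝ f p) (p + (0 : ℝ) • c) := by simpa using hd.hasFDerivAt
    exact hd'.comp_hasDerivAt (0 : ℝ) hl

/-- An inclusion between spaces of dimension two. It serves every parametrization, as the
definitions of totally geodesic and of shape values quantify over all of them. -/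
theorem range_fderiv_eq_conormalPerp (h : IsLorentzPair n₁ n₂) {U : Set E2} {f : E2 → E4}
    (hf : IsLocalParam (conormalPlane n₁ n₂) U f) {p : E2} (hp : p ∈ U) :
    LinearMap.range (fderiv ℝ f p : E2 →ₗ[ℝ] E4) = conormalPerp n₁ n₂ (f p) := by
  refine Submodule.eq_of_le_of_finrank_eq
    ((range_fderiv_le_tangentPlane hf hp).trans tangentPlane_le) ?_
  rw [finrank_conormalPerp h (hf.mapsTo hp), LinearMap.finrank_range_of_inj (hf.immersion p hp),
    finrank_euclideanSpace_fin]

theorem tangentPlane_eq_conormalPerp_of_isLocalParam (h : IsLorentzPair n₁ n₂) {U : Set E2}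
    {f : E2 → E4} (hf : IsLocalParam (conormalPlane n₁ n₂) U f) {p : E2} (hp : p ∈ U) :
    tangentPlane (conormalPlane n₁ n₂) (f p) = conormalPerp n₁ n₂ (f p) :=
  le_antisymm tangentPlane_le
    ((range_fderiv_eq_conormalPerp h hf hp).symm.le.trans (range_fderiv_le_tangentPlane hf hp))

end LorentzPair

/-! ### The global parametrization -/

/-- The parametrization of the hyperboloid of the span of `w₀, w₁, w₂`. -/
def hyperboloidParam (w₀ w₁ w₂ : E4 × ℝ) (p : E2) : E4 × ℝ :=
  √(1 + ‖p‖ ^ 2) • w₀ + p 0 • w₁ + p 1 • w₂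

/-- The parametrization of a hyperbolic plane of the ball. -/
def planeParam (w₀ w₁ w₂ : E4 × ℝ) (p : E2) : E4 := hypStereoInv (hyperboloidParam w₀ w₁ w₂ p)

/-- The coordinates of a hyperbolic plane, inverse to `planeParam`. -/
def planeCoord (w₁ w₂ : E4 × ℝ) (x : E4) : E2 :=
  WithLp.toLp 2 ![lorentz w₁ (hypStereo x), lorentz w₂ (hypStereo x)]

namespace IsLorentzFrame

variable {w₀ w₁ w₂ n₁ n₂ : E4 × ℝ}

theorem isLorentzPair (h : IsLorentzFrame w₀ w₁ w₂ n₁ n₂) : IsLorentzPair n₁ n₂ :=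
  ⟨h.n₁₁, h.n₂₂, h.n₁₂⟩

theorem lorentz_hyperboloidParam₀ (h : IsLorentzFrame w₀ w₁ w₂ n₁ n₂) (p : E2) :
    lorentz w₀ (hyperboloidParam w₀ w₁ w₂ p) = -√(1 + ‖p‖ ^ 2) := by
  simp only [hyperboloidParam, lorentz_add_right, lorentz_smul_right, h.w₀₀, h.w₀₁, h.w₀₂]
  ring

theorem lorentz_hyperboloidParam₁ (h : IsLorentzFrame w₀ w₁ w₂ n₁ n₂) (p : E2) :
    lorentz w₁ (hyperboloidParam w₀ w₁ w₂ p) = p 0 := by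
  simp only [hyperboloidParam, lorentz_add_right, lorentz_smul_right, h.w₁₁, h.w₁₂,
    lorentz_comm w₁ w₀, h.w₀₁]
  ring

theorem lorentz_hyperboloidParam₂ (h : IsLorentzFrame w₀ w₁ w₂ n₁ n₂) (p : E2) :
    lorentz w₂ (hyperboloidParam w₀ w₁ w₂ p) = p 1 := by
  simp only [hyperboloidParam, lorentz_add_right, lorentz_smul_right, h.w₂₂, h.w₁₂,
    lorentz_comm w₂ w₀, lorentz_comm w₂ w₁, h.w₀₂]
  ring

theorem lorentz_hyperboloidParam (h : IsLorentzFrame w₀ w₁ w₂ n₁ n₂) (p : E2) :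
    lorentz (hyperboloidParam w₀ w₁ w₂ p) (hyperboloidParam w₀ w₁ w₂ p) = -1 := by
  conv_lhs => arg 1; rw [hyperboloidParam]
  rw [lorentz_add_left, lorentz_add_left, lorentz_smul_left, lorentz_smul_left, lorentz_smul_left,
    h.lorentz_hyperboloidParam₀, h.lorentz_hyperboloidParam₁, h.lorentz_hyperboloidParam₂, mul_neg,
    Real.mul_self_sqrt (by positivity), EuclideanSpace.real_norm_sq_eq, Fin.sum_univ_two]
  ring

theorem hyperboloidParam_future (h : IsLorentzFrame w₀ w₁ w₂ n₁ n₂) (p : E2) :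
    0 < (hyperboloidParam w₀ w₁ w₂ p).2 := by
  rw [← lorentz_neg_iff_of_timelike (w := w₀) (by rw [h.w₀₀]; norm_num) h.future
    (by rw [h.lorentz_hyperboloidParam]; norm_num), h.lorentz_hyperboloidParam₀, neg_lt_zero]
  positivity

theorem hypStereo_planeParam (h : IsLorentzFrame w₀ w₁ w₂ n₁ n₂) (p : E2) :
    hypStereo (planeParam w₀ w₁ w₂ p) = hyperboloidParam w₀ w₁ w₂ p :=
  hypStereo_hypStereoInv (h.lorentz_hyperboloidParam p) (h.hyperboloidParam_future p)

theorem planeParam_mem (h : IsLorentzFrame w₀ w₁ w₂ n₁ n₂) (p : E2) :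
    planeParam w₀ w₁ w₂ p ∈ conormalPlane n₁ n₂ := by
  refine ⟨hypStereoInv_mem (h.lorentz_hyperboloidParam p) (h.hyperboloidParam_future p), ?_⟩
  rw [h.hypStereo_planeParam, h.orthogonal_iff, h.lorentz_hyperboloidParam₀,
    h.lorentz_hyperboloidParam₁, h.lorentz_hyperboloidParam₂, neg_neg]
  rfl

theorem planeCoord_planeParam (h : IsLorentzFrame w₀ w₁ w₂ n₁ n₂) (p : E2) :
    planeCoord w₁ w₂ (planeParam w₀ w₁ w₂ p) = p := by
  ext i
  rw [planeCoord, h.hypStereo_planeParam, h.lorentz_hyperboloidParam₁,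
    h.lorentz_hyperboloidParam₂]
  fin_cases i <;> rfl

theorem planeParam_planeCoord (h : IsLorentzFrame w₀ w₁ w₂ n₁ n₂) {x : E4}
    (hx : x ∈ conormalPlane n₁ n₂) : planeParam w₀ w₁ w₂ (planeCoord w₁ w₂ x) = x := by
  have hy := (h.orthogonal_iff _).1 hx.2
  have hyy := lorentz_hypStereo hx.1
  have hneg := (lorentz_neg_iff_of_timelike (by rw [h.w₀₀]; norm_num) h.future
    (by rw [hyy]; norm_num)).2 (hypStereo_future hx.1)
  -- The coordinate along `w₀` is recovered from the other two: its square by the hyperboloid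
  -- equation, its sign by being on the future sheet.
  have hp : √(1 + ‖planeCoord w₁ w₂ x‖ ^ 2) = -lorentz w₀ (hypStereo x) := by
    rw [Real.sqrt_eq_iff_mul_self_eq (by positivity) (by linarith), EuclideanSpace.real_norm_sq_eq,
      Fin.sum_univ_two]
    simp only [planeCoord, Matrix.cons_val]
    nth_rw 1 [hy] at hyy
    simp only [lorentz_add_left, lorentz_smul_left] at hyy
    linarith
  have : hyperboloidParam w₀ w₁ w₂ (planeCoord w₁ w₂ x) = hypStereo x := by
    rw [hyperboloidParam, hp]
    exact hy.symm
  rw [planeParam, this, hypStereoInv_hypStereo hx.1]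

theorem contDiff_planeParam (h : IsLorentzFrame w₀ w₁ w₂ n₁ n₂) :
    ContDiff ℝ ∞ (planeParam w₀ w₁ w₂) := by
  have hcoord : ∀ i : Fin 2, ContDiff ℝ ∞ fun p : E2 => p i := fun i =>
    (EuclideanSpace.proj (𝕜 := ℝ) i).contDiff
  have hs : ContDiff ℝ ∞ fun p : E2 => √(1 + ‖p‖ ^ 2) :=
    (contDiff_const.add (contDiff_norm_sq ℝ)).sqrt fun p => by positivity
  have hy : ContDiff ℝ ∞ (hyperboloidParam w₀ w₁ w₂) :=
    ((hs.smul contDiff_const).add ((hcoord 0).smul contDiff_const)).add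
      ((hcoord 1).smul contDiff_const)
  exact ((contDiff_const.add hy.snd).inv fun p => by
    have := h.hyperboloidParam_future p; positivity).smul hy.fst

theorem contDiffAt_planeCoord (w₁ w₂ : E4 × ℝ) {x : E4} (hx : x ∈ unitBall4) :
    ContDiffAt ℝ ∞ (planeCoord w₁ w₂) x := by
  have hne := (one_sub_norm_sq_pos hx).ne'
  have hn : ContDiffAt ℝ ∞ (fun x : E4 => ‖x‖ ^ 2) x := (contDiff_norm_sq ℝ).contDiffAt
  have hσ : ContDiffAt ℝ ∞ hypStereo x :=
    ((contDiffAt_const.div (contDiffAt_const.sub hn) hne).smul contDiffAt_id).prodMk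
      ((contDiffAt_const.add hn).div (contDiffAt_const.sub hn) hne)
  have hl : ∀ w : E4 × ℝ, ContDiffAt ℝ ∞ (fun x => lorentz w (hypStereo x)) x := fun w =>
    (contDiffAt_const.inner ℝ hσ.fst).sub (contDiffAt_const.mul hσ.snd)
  rw [contDiffAt_euclidean]
  intro i
  fin_cases i
  exacts [hl w₁, hl w₂]

theorem isOpen_unitBall4 : IsOpen unitBall4 := isOpen_lt continuous_norm continuous_const

/-- The left inverse `planeCoord` is smooth on the whole ball. This yields injectivity, the
immersion property by the chain rule, and relative openness by taking preimages. -/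
theorem isLocalParam (h : IsLorentzFrame w₀ w₁ w₂ n₁ n₂) :
    IsLocalParam (conormalPlane n₁ n₂) Set.univ (planeParam w₀ w₁ w₂) where
  isOpen := isOpen_univ
  smooth := h.contDiff_planeParam.contDiffOn
  mapsTo p _ := h.planeParam_mem p
  injOn := (Function.LeftInverse.injective h.planeCoord_planeParam).injOn
  immersion p _ := by
    have hg := ((contDiffAt_planeCoord w₁ w₂ (h.planeParam_mem p).1).differentiableAt
      (by simp)).hasFDerivAt
    have hf := (h.contDiff_planeParam.contDiffAt.differentiableAt (x := p) (by simp)).hasFDerivAt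
    have hid := hg.comp p hf
    rw [show planeCoord w₁ w₂ ∘ planeParam w₀ w₁ w₂ = id from
      funext h.planeCoord_planeParam] at hid
    have := hid.unique (hasFDerivAt_id p)
    refine Function.LeftInverse.injective 
      (g := fderiv ℝ (planeCoord w₁ w₂) (planeParam w₀ w₁ w₂ p)) fun v => ?_
    exact DFunLike.congr_fun this v
  relOpen O _ hO := by
    refine ⟨unitBall4 ∩ planeCoord w₁ w₂ ⁻¹' O, ?_, ?_⟩
    · exact ContinuousOn.isOpen_inter_preimage (fun x hx =>
        (contDiffAt_planeCoord w₁ w₂ hx).continuousAt.continuousWithinAt) isOpen_unitBall4 hO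
    · ext x
      constructor
      · rintro ⟨p, hp, rfl⟩
        refine ⟨h.planeParam_mem p, (h.planeParam_mem p).1, ?_⟩
        rwa [Set.mem_preimage, h.planeCoord_planeParam]
      · rintro ⟨hx, -, hp⟩
        exact ⟨_, hp, h.planeParam_planeCoord hx⟩

theorem isEmbeddedSurface (h : IsLorentzFrame w₀ w₁ w₂ n₁ n₂) :
    IsEmbeddedSurface (conormalPlane n₁ n₂) :=
  ⟨fun _ hx => hx.1, fun x hx => ⟨Set.univ, _, h.isLocalParam, planeCoord w₁ w₂ x,
    Set.mem_univ _, h.planeParam_planeCoord hx⟩⟩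

theorem tangentPlane_eq (h : IsLorentzFrame w₀ w₁ w₂ n₁ n₂) {x : E4}
    (hx : x ∈ conormalPlane n₁ n₂) :
    tangentPlane (conormalPlane n₁ n₂) x = conormalPerp n₁ n₂ x := by
  rw [← h.planeParam_planeCoord hx]
  exact tangentPlane_eq_conormalPerp_of_isLocalParam h.isLorentzPair h.isLocalParam
    (Set.mem_univ _)

end IsLorentzFrame

/-! ### The Levi-Civita connection and totally geodesic planes -/

theorem fderiv_gh {x : E4} (hx : x ∈ unitBall4) (u v w : E4) :
    fderiv ℝ (fun y => gh y u v) x w =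
      16 * inner ℝ x w / (1 - ‖x‖ ^ 2) ^ 3 * inner ℝ u v := by
  have hne := (one_sub_norm_sq_pos hx).ne'
  have h1 : HasFDerivAt (fun y : E4 => 1 - ‖y‖ ^ 2) (-(2 • innerSL ℝ x)) x :=
    (hasStrictFDerivAt_norm_sq x).hasFDerivAt.const_sub 1
  have h2 := (((hasDerivAt_pow (𝕜 := ℝ) 2 (1 - ‖x‖ ^ 2)).inv (pow_ne_zero 2 hne)).comp_hasFDerivAt x
    h1).const_mul (4 * inner ℝ u v)
  have h3 : (fun y : E4 => gh y u v) = fun y => 4 * inner ℝ u v *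
      ((fun t : ℝ => t ^ 2)⁻¹ ∘ fun y : E4 => 1 - ‖y‖ ^ 2) y := by
    funext y
    simp only [gh, Function.comp, Pi.inv_apply]
    ring
  rw [h3, h2.fderiv]
  simp
  field_simp
  ring

/-- The usual formula for a conformal metric `λ²|dx|²`, where `λ = 2 / (1 - |x|²)` and `∇ log λ = 2x
/ (1 - |x|²)`. -/
theorem christoffel_eq {x : E4} (hx : x ∈ unitBall4) (u v : E4) :
    christoffel x u v = (2 / (1 - ‖x‖ ^ 2)) •
      (inner ℝ x u • v + inner ℝ x v • u - inner ℝ u v • x) := by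
  have hne := (one_sub_norm_sq_pos hx).ne'
  have hk : ∀ (y : E4) (k : Fin 4), inner ℝ y (stdVec k) = y k := fun y k => by
    rw [stdVec, EuclideanSpace.inner_single_right]; simp
  ext j
  simp only [christoffel, fderiv_gh hx, hk]
  simp only [stdVec, PiLp.smul_apply, PiLp.add_apply, PiLp.sub_apply, WithLp.ofLp_sum,
    Finset.sum_apply, PiLp.single_apply, smul_eq_mul, mul_ite, mul_one, mul_zero,
    Finset.sum_ite_eq, Finset.mem_univ, if_true]
  field_simp
  ring

theorem gh_eq_zero_iff {x : E4} (hx : x ∈ unitBall4) (u v : E4) :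
    gh x u v = 0 ↔ inner ℝ u v = 0 := by
  have := one_sub_norm_sq_pos hx
  rw [gh, mul_eq_zero, or_iff_right (by positivity)]

section LorentzPair

variable {n₁ n₂ : E4 × ℝ} {x : E4}

/-- The second fundamental form of the hypersurface `n ∘ σ(x) = 0` vanishes. -/
theorem inner_conormal_covHess {U : Set E2} {f : E2 → E4} (hU : IsOpen U)
    (hf : ContDiffOn ℝ ∞ f U) (hball : ∀ q ∈ U, f q ∈ unitBall4) {n : E4 × ℝ}
    (hn : ∀ q ∈ U, 2 * inner ℝ n.1 (f q) = n.2 * (1 + ‖f q‖ ^ 2)) {p : E2} (hp : p ∈ U)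
    (a c : E2) : inner ℝ (conormal n (f p)) (covHess f p a c) = 0 := by
  have hd : ∀ q ∈ U, HasFDerivAt f (fderiv ℝ f q) q := fun q hq =>
    ((hf.contDiffAt (hU.mem_nhds hq)).differentiableAt (by simp)).hasFDerivAt
  have first : ∀ q ∈ U, ∀ b, inner ℝ (conormal n (f q)) (fderiv ℝ f q b) = 0 := by
    intro q hq b
    have h1 := (((hasFDerivAt_const n.1 q).inner ℝ (hd q hq)).const_mul 2).sub
      (((hd q hq).norm_sq.const_add 1).const_mul n.2)
    have h2 : ((fun q => 2 * inner ℝ n.1 (f q)) - fun q => n.2 * (1 + ‖f q‖ ^ 2))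
        =ᶠ[nhds q] fun _ => (0 : ℝ) := by
      filter_upwards [hU.mem_nhds hq] with r hr
      simp [hn r hr]
    have h3 := (h1.congr_of_eventuallyEq h2.symm).unique (hasFDerivAt_const (0 : ℝ) q)
    have h4 := DFunLike.congr_fun h3 b
    simp at h4
    rw [conormal, inner_sub_left, real_inner_smul_left]
    linarith
  have hd2 : HasFDerivAt (fun q => fderiv ℝ f q c) (fderiv ℝ (fun q => fderiv ℝ f q c) p) p := by
    have h1 : ContDiffAt ℝ 1 (fderiv ℝ f) p :=
      (hf.contDiffAt (hU.mem_nhds hp)).fderiv_right (by norm_cast)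
    exact ((h1.differentiableAt (by simp)).clm_apply (differentiableAt_const c)).hasFDerivAt
  -- Differentiation of `first` in the direction `a`; the derivative of the conormal is `-n.2` times
  -- that of `f`.
  have second : inner ℝ (conormal n (f p)) (fderiv ℝ (fun q => fderiv ℝ f q c) p a)
      = n.2 * inner ℝ (fderiv ℝ f p a) (fderiv ℝ f p c) := by
    have h0 : HasFDerivAt (fun q => conormal n (f q)) (-(n.2 • fderiv ℝ f p)) p :=
      ((hd p hp).const_smul n.2).const_sub n.1
    have h1 := h0.inner ℝ hd2
    have h2 : (fun q => inner ℝ (conormal n (f q)) (fderiv ℝ f q c))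
        =ᶠ[nhds p] fun _ => (0 : ℝ) := by
      filter_upwards [hU.mem_nhds hp] with r hr using first r hr c
    have h3 := (h1.congr_of_eventuallyEq h2.symm).unique (hasFDerivAt_const (0 : ℝ) p)
    have h4 := DFunLike.congr_fun h3 a
    simp [real_inner_smul_left] at h4
    linarith
  have hx := one_sub_norm_sq_pos (hball p hp)
  -- With this value the position term of the Christoffel map contributes `-n.2 ⟨df a, df c⟩`, the
  -- opposite of `second`.
  have hnx : inner ℝ (conormal n (f p)) (f p) = n.2 * (1 - ‖f p‖ ^ 2) / 2 := by
    rw [conormal, inner_sub_left, real_inner_smul_left, real_inner_self_eq_norm_sq]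
    linarith [hn p hp]
  rw [covHess, inner_add_right, second, christoffel_eq (hball p hp), real_inner_smul_right,
    inner_sub_right, inner_add_right, real_inner_smul_right, real_inner_smul_right,
    real_inner_smul_right, first p hp, first p hp, hnx]
  field_simp
  ring

/-- The covariant Hessian is orthogonal to both conormals, so it is itself tangent. -/
theorem inner_covHess_eq_zero {U : Set E2} {f : E2 → E4}
    (hf : IsLocalParam (conormalPlane n₁ n₂) U f) {p : E2} (hp : p ∈ U) {n : E4}
    (hn : ∀ v ∈ conormalPerp n₁ n₂ (f p), inner ℝ n v = 0) (a c : E2) :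
    inner ℝ n (covHess f p a c) = 0 := by
  refine hn _ (mem_conormalPerp.2 ⟨?_, ?_⟩)
  · exact inner_conormal_covHess hf.isOpen hf.smooth (fun q hq => (hf.mapsTo hq).1)
      (fun q hq => conormalPlane_eq₁ (hf.mapsTo hq)) hp a c
  · exact inner_conormal_covHess hf.isOpen hf.smooth (fun q hq => (hf.mapsTo hq).1)
      (fun q hq => conormalPlane_eq₂ (hf.mapsTo hq)) hp a c

theorem isTotallyGeodesic_conormalPlane (h : IsLorentzPair n₁ n₂) :
    IsTotallyGeodesic (conormalPlane n₁ n₂) := by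
  intro U f hf p hp n hn a c
  have hx := (hf.mapsTo hp).1
  rw [gh_eq_zero_iff hx]
  refine inner_covHess_eq_zero hf hp (fun v hv => ?_) a c
  rw [← tangentPlane_eq_conormalPerp_of_isLocalParam h hf hp] at hv
  exact (gh_eq_zero_iff hx n v).1 (hn v hv)

end LorentzPair

namespace IsLorentzFrame

variable {w₀ w₁ w₂ n₁ n₂ : E4 × ℝ}

/-- The second fundamental form takes only the value zero. -/
theorem isShapeValue_iff (h : IsLorentzFrame w₀ w₁ w₂ n₁ n₂) {x n v s : E4}
    (hx : x ∈ conormalPlane n₁ n₂) (hn : IsNormal (conormalPlane n₁ n₂) x n)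
    (hv : v ∈ tangentPlane (conormalPlane n₁ n₂) x) :
    IsShapeValue (conormalPlane n₁ n₂) x n v s ↔ s = 0 := by
  have hgeo := isTotallyGeodesic_conormalPlane h.isLorentzPair
  constructor
  · rintro ⟨hs, U, f, p, a, hf, hp, rfl, rfl, hshape⟩
    have hs' : s ∈ LinearMap.range (fderiv ℝ f p : E2 →ₗ[ℝ] E4) := by
      rwa [range_fderiv_eq_conormalPerp h.isLorentzPair hf hp, ← h.tangentPlane_eq hx]
    -- Choosing the test direction to be `s` itself gives `g(s, s) = 0`.
    obtain ⟨c, hc⟩ := hs'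
    have h1 := hshape c
    rw [hgeo U f hf p hp n hn, gh_eq_zero_iff hx.1] at h1
    rw [show fderiv ℝ f p c = s from hc] at h1
    exact inner_self_eq_zero.1 h1
  · rintro rfl
    have hp := h.planeParam_planeCoord hx
    have hv' : v ∈ LinearMap.range (fderiv ℝ (planeParam w₀ w₁ w₂) (planeCoord w₁ w₂ x) :
        E2 →ₗ[ℝ] E4) := by
      rwa [range_fderiv_eq_conormalPerp h.isLorentzPair h.isLocalParam (Set.mem_univ _), hp,
        ← h.tangentPlane_eq hx]
    obtain ⟨a, ha⟩ := hv'
    refine ⟨Submodule.zero_mem _, Set.univ, _, _, a, h.isLocalParam, Set.mem_univ _, hp, ha,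
      fun c => ?_⟩
    have h1 := hgeo Set.univ _ h.isLocalParam (planeCoord w₁ w₂ x) (Set.mem_univ _) n
      (by rwa [hp]) a c
    rw [hp] at h1
    rw [h1, gh_eq_zero_iff hx.1, inner_zero_left]

/-- All circles have radius 0, so the orientation clause is vacuous and neither `ε` nor `θ` matters.
A unit normal is still needed to see that 0 belongs to the indicatrix. -/
theorem isSuperminimal (h : IsLorentzFrame w₀ w₁ w₂ n₁ n₂) (ε : ℤˣ)
    (θ : E4 → E4 [⋀^Fin 2]→L[ℝ] ℝ) : IsSuperminimal ε (conormalPlane n₁ n₂) θ := by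
  intro x hx v hv _
  refine ⟨0, le_rfl, ?_, fun h0 => absurd h0 (lt_irrefl _)⟩
  have hpos := one_sub_norm_sq_pos hx.1
  ext s
  constructor
  · rintro ⟨n, hn, -, hs⟩
    rw [(h.isShapeValue_iff hx hn hv).1 hs]
    exact ⟨Submodule.zero_mem _, by simp [gh]⟩
  · rintro ⟨hs, hs0⟩
    rw [zero_pow two_ne_zero, gh_eq_zero_iff hx.1, inner_self_eq_zero] at hs0
    subst hs0
    -- The factor `(1 - |x|²) / 2` turns the Euclidean unit conormal into a unit vector of the
    -- hyperbolic metric.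
    have hn : IsNormal (conormalPlane n₁ n₂) x (((1 - ‖x‖ ^ 2) / 2) • conormal n₁ x) := by
      intro v hv
      rw [h.tangentPlane_eq hx] at hv
      rw [gh_eq_zero_iff hx.1, real_inner_smul_left, (mem_conormalPerp.1 hv).1, mul_zero]
    refine ⟨_, hn, ?_, (h.isShapeValue_iff hx hn hv).2 rfl⟩
    rw [gh, real_inner_smul_left, real_inner_smul_right, real_inner_self_eq_norm_sq,
      norm_conormal₁ h.isLorentzPair hx]
    field_simp
    norm_num

end IsLorentzFrame

/-! ### Imaginary unit quaternions -/

theorem inner_quatR4_symm (x y : E4) : inner ℝ (quatR4.symm x) (quatR4.symm y) = inner ℝ x y :=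
  quatR4.symm.inner_map_map x y

/-- An imaginary unit quaternion. -/
structure IsImaginaryUnit (u : Quaternion ℝ) : Prop where
  star_eq : star u = -u
  mul_self : u * u = -1

namespace IsImaginaryUnit

variable {u : Quaternion ℝ}

theorem re_eq (hu : IsImaginaryUnit u) : u.re = 0 := by
  have := congrArg (fun q : Quaternion ℝ => q.re) hu.star_eq
  simp at this
  linarith

theorem im_eq (hu : IsImaginaryUnit u) : u.im = u := by
  ext <;> simp [hu.re_eq]

theorem ne_zero (hu : IsImaginaryUnit u) : u ≠ 0 := by
  rintro rfl
  simpa using hu.mul_self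

theorem inner_mul_left (hu : IsImaginaryUnit u) (a b : Quaternion ℝ) :
    inner ℝ (u * a) b = -inner ℝ a (u * b) := by
  have hre := hu.re_eq
  simp [Quaternion.inner_def, hre]
  ring

theorem inner_mul_mul (hu : IsImaginaryUnit u) (a b : Quaternion ℝ) :
    inner ℝ (u * a) (u * b) = inner ℝ a b := by
  rw [hu.inner_mul_left, ← mul_assoc, hu.mul_self, neg_one_mul, inner_neg_right, neg_neg]

theorem inner_mul_self (hu : IsImaginaryUnit u) (a : Quaternion ℝ) : inner ℝ (u * a) a = 0 := by
  have := hu.inner_mul_left a a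
  rw [real_inner_comm] at this ⊢
  linarith

end IsImaginaryUnit

theorem isImaginaryUnit_of_re_eq_zero {u : Quaternion ℝ} (h : u.re = 0) (hn : ‖u‖ = 1) :
    IsImaginaryUnit u := by
  have hs : star u = -u := by ext <;> simp [h]
  refine ⟨hs, ?_⟩
  have := Quaternion.self_mul_star u
  rw [hs, Quaternion.normSq_eq_norm_mul_self, hn] at this
  rw [← neg_neg (u * u), ← mul_neg, this]
  simp

theorem isImaginaryUnit_quatI : IsImaginaryUnit quatI :=
  by
  refine ⟨?_, quatI_mul_quatI⟩
  rw [quatI_eq]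
  ext <;> simp [quatOfPair_re, quatOfPair_imI, quatOfPair_imJ, quatOfPair_imK]

/-- Left multiplication by a quaternion on `ℝ⁴`. -/
def leftMul (u : Quaternion ℝ) (t : E4) : E4 := quatR4 (u * quatR4.symm t)

theorem symm_leftMul (u : Quaternion ℝ) (t : E4) :
    quatR4.symm (leftMul u t) = u * quatR4.symm t := quatR4.symm_apply_apply _

theorem leftMul_add (u : Quaternion ℝ) (s t : E4) :
    leftMul u (s + t) = leftMul u s + leftMul u t := by
  rw [leftMul, map_add, mul_add, map_add]; rfl

theorem leftMul_smul (u : Quaternion ℝ) (c : ℝ) (t : E4) :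
    leftMul u (c • t) = c • leftMul u t := by
  rw [leftMul, map_smul, mul_smul_comm, map_smul]; rfl

theorem neg_leftMul (u : Quaternion ℝ) (t : E4) : leftMul (-u) t = -leftMul u t := by
  rw [leftMul, neg_mul, map_neg]; rfl

theorem add_leftMul (u v : Quaternion ℝ) (t : E4) :
    leftMul (u + v) t = leftMul u t + leftMul v t := by
  rw [leftMul, add_mul, map_add]; rfl

theorem smul_leftMul (c : ℝ) (u : Quaternion ℝ) (t : E4) :
    leftMul (c • u) t = c • leftMul u t := by
  rw [leftMul, smul_mul_assoc, map_smul]; rfl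

theorem continuous_leftMul : Continuous fun p : Quaternion ℝ × E4 => leftMul p.1 p.2 :=
  quatR4.continuous.comp (continuous_fst.mul (quatR4.symm.continuous.comp continuous_snd))

/-- In a division ring one nonzero vector determines a left multiplication, so testing a complex
structure on a single tangent vector identifies it. -/
theorem leftMul_right_cancel {u v : Quaternion ℝ} {t : E4} (ht : t ≠ 0)
    (h : leftMul u t = leftMul v t) : u = v :=
  mul_right_cancel₀ ((map_ne_zero_iff _ quatR4.symm.injective).2 ht) (quatR4.injective h)

namespace IsImaginaryUnit

variable {u : Quaternion ℝ}

theorem leftMul_leftMul (hu : IsImaginaryUnit u) (t : E4) : leftMul u (leftMul u t) = -t := by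
  rw [leftMul, symm_leftMul, ← mul_assoc, hu.mul_self, neg_one_mul, map_neg,
    LinearIsometryEquiv.apply_symm_apply]

theorem inner_leftMul_left (hu : IsImaginaryUnit u) (s t : E4) :
    inner ℝ (leftMul u s) t = -inner ℝ s (leftMul u t) := by
  rw [← inner_quatR4_symm, ← inner_quatR4_symm, symm_leftMul, symm_leftMul, hu.inner_mul_left]

theorem inner_leftMul_self (hu : IsImaginaryUnit u) (t : E4) : inner ℝ t (leftMul u t) = 0 := by
  rw [real_inner_comm, ← inner_quatR4_symm, symm_leftMul, hu.inner_mul_self]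

theorem inner_leftMul_leftMul (hu : IsImaginaryUnit u) (s t : E4) :
    inner ℝ (leftMul u s) (leftMul u t) = inner ℝ s t := by
  rw [← inner_quatR4_symm, symm_leftMul, symm_leftMul, hu.inner_mul_mul, inner_quatR4_symm]

theorem leftMul_ne_zero (hu : IsImaginaryUnit u) {t : E4} (ht : t ≠ 0) : leftMul u t ≠ 0 :=
  fun h => ht <| by
    have := hu.leftMul_leftMul t
    rw [h, leftMul, map_zero, mul_zero, map_zero] at this
    exact neg_eq_zero.1 this.symm

end IsImaginaryUnit

/-! ### Planes and alternating forms -/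

theorem exists_eq_add_smul_of_finrank_two {S : Submodule ℝ E4} (hS : Module.finrank ℝ S = 2)
    {t t' : E4} (ht : t ∈ S) (ht' : t' ∈ S) (h0 : t ≠ 0) (h0' : t' ≠ 0) (h : inner ℝ t t' = 0)
    {s : E4} (hs : s ∈ S) : ∃ c d : ℝ, s = c • t + d • t' := by
  have hli : LinearIndependent ℝ ![t, t'] := by
    refine linearIndependent_of_ne_zero_of_inner_eq_zero (𝕜 := ℝ) (fun i => ?_) fun i j hij => ?_
    · fin_cases i
      exacts [h0, h0']
    · fin_cases i <;> fin_cases j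
      exacts [absurd rfl hij, h, (real_inner_comm _ _).trans h, absurd rfl hij]
  have hspan : Submodule.span ℝ (Set.range ![t, t']) = S := by
    refine Submodule.eq_of_le_of_finrank_le (Submodule.span_le.2 ?_) ?_
    · rintro _ ⟨i, rfl⟩
      fin_cases i
      exacts [ht, ht']
    · rw [hS, finrank_span_eq_card hli]; simp
  rw [← hspan, Submodule.mem_span_range_iff_exists_fun] at hs
  obtain ⟨c, rfl⟩ := hs
  exact ⟨c 0, c 1, by simp [Fin.sum_univ_two]⟩

theorem alternating_pair_combination (θ : E4 [⋀^Fin 2]→L[ℝ] ℝ) (t s : E4) (a b c d : ℝ) :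
    θ ![a • t + b • s, c • t + d • s] = (a * d - b * c) * θ ![t, s] := by
  have hadd : ∀ x y z : E4, θ ![x + y, z] = θ ![x, z] + θ ![y, z] := fun x y z =>
    θ.map_vecCons_add ![z] x y
  have hsmul : ∀ (r : ℝ) (x z : E4), θ ![r • x, z] = r * θ ![x, z] := fun r x z =>
    θ.map_vecCons_smul ![z] r x
  have hself : ∀ x, θ ![x, x] = 0 := fun x =>
    θ.map_eq_zero_of_eq ![x, x] (i := 0) (j := 1) rfl (by simp)
  have hswap : ∀ x y, θ ![x, y] = -θ ![y, x] := fun x y => by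
    have h4 := θ.map_swap ![y, x] (i := 0) (j := 1) (by simp)
    have e4 : ![y, x] ∘ Equiv.swap (0 : Fin 2) 1 = ![x, y] := by
      funext i; fin_cases i <;> rfl
    rw [e4] at h4
    exact h4
  rw [hadd, hsmul, hsmul, hswap t, hswap s, hadd, hadd, hsmul, hsmul, hsmul, hsmul, hself, hself,
    hswap s t]
  ring

/-- The 2-form `(t, t') ↦ ⟨Im(u) t, t'⟩`, as a linear function of the quaternion `u`. -/
def rotationForm : Quaternion ℝ →ₗ[ℝ] E4 [⋀^Fin 2]→L[ℝ] ℝ where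
  toFun u :=
    { toFun := fun m => inner ℝ (leftMul u.im (m 0)) (m 1)
      map_update_add' := by
        intro _ m i x y
        fin_cases i <;> simp [leftMul_add, inner_add_left, inner_add_right]
      map_update_smul' := by
        intro _ m i c x
        fin_cases i <;> simp [leftMul_smul, inner_smul_left, inner_smul_right]
      cont := by
        exact (continuous_leftMul.comp (continuous_const.prodMk (continuous_apply 0))).inner
          (continuous_apply 1)
      map_eq_zero_of_eq' := by
        intro m i j hij hne
        have h01 : m 0 = m 1 := by
          fin_cases i <;> fin_cases j
          exacts [absurd rfl hne, hij, hij.symm, absurd rfl hne]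
        -- The value on `(t, t)` is the real part of `Im(u) t t̄`, a real multiple of `Im(u)`.
        -- Taking the imaginary part makes the form alternating for every `u`, so that it is linear
        -- on all of `ℍ`.
        rw [h01, ← inner_quatR4_symm, symm_leftMul, Quaternion.inner_def, mul_assoc,
          Quaternion.self_mul_star]
        simp }
  map_add' u v := by
    ext m
    change inner ℝ (leftMul (u + v).im (m 0)) (m 1) = inner ℝ (leftMul u.im (m 0)) (m 1) +
      inner ℝ (leftMul v.im (m 0)) (m 1)
    rw [Quaternion.im_add, add_leftMul, inner_add_left]
  map_smul' c u := by
    ext m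
    change inner ℝ (leftMul (c • u).im (m 0)) (m 1) = c * inner ℝ (leftMul u.im (m 0)) (m 1)
    rw [Quaternion.im_smul, smul_leftMul, real_inner_smul_left]

theorem rotationForm_apply (u : Quaternion ℝ) (t s : E4) :
    rotationForm u ![t, s] = inner ℝ (leftMul u.im t) s := rfl

/-! ### The rotation of the tangent planes -/

/-- The quaternion whose left multiplication rotates `conormal n₁ x` to `conormal n₂ x`. -/
def conormalRotation (n₁ n₂ : E4 × ℝ) (x : E4) : Quaternion ℝ :=
  quatR4.symm (conormal n₂ x) * star (quatR4.symm (conormal n₁ x))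

theorem continuous_conormalRotation (n₁ n₂ : E4 × ℝ) : Continuous (conormalRotation n₁ n₂) := by
  have h : ∀ n : E4 × ℝ, Continuous fun x => quatR4.symm (conormal n x) := fun n =>
    quatR4.symm.continuous.comp (continuous_const.sub (continuous_id.const_smul n.2))
  exact (h n₂).mul (h n₁).star

section LorentzPair

variable {n₁ n₂ : E4 × ℝ} {x : E4}

/-- The real part of `ν₂ ν̄₁` is the inner product of the conormals, and its norm is the product of
their norms. -/
theorem conormalRotation_isImaginaryUnit (h : IsLorentzPair n₁ n₂)
    (hx : x ∈ conormalPlane n₁ n₂) : IsImaginaryUnit (conormalRotation n₁ n₂ x) := by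
  refine isImaginaryUnit_of_re_eq_zero ?_ ?_
  · rw [conormalRotation, ← Quaternion.inner_def, inner_quatR4_symm, real_inner_comm,
      inner_conormal₁₂ h hx]
  · rw [conormalRotation, norm_mul, Quaternion.norm_star, LinearIsometryEquiv.norm_map,
      LinearIsometryEquiv.norm_map, norm_conormal₁ h hx, norm_conormal₂ h hx, one_mul]

theorem star_mul_conormal₁ (h : IsLorentzPair n₁ n₂) (hx : x ∈ conormalPlane n₁ n₂) :
    star (quatR4.symm (conormal n₁ x)) * quatR4.symm (conormal n₁ x) = 1 := by
  rw [Quaternion.star_mul_self, Quaternion.normSq_eq_norm_mul_self, LinearIsometryEquiv.norm_map,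
    norm_conormal₁ h hx]
  simp

theorem eq_conormalRotation_iff (h : IsLorentzPair n₁ n₂) (hx : x ∈ conormalPlane n₁ n₂)
    (u : Quaternion ℝ) : u = conormalRotation n₁ n₂ x ↔
      u * quatR4.symm (conormal n₁ x) = quatR4.symm (conormal n₂ x) := by
  have h1 := star_mul_conormal₁ h hx
  constructor
  · rintro rfl
    rw [conormalRotation, mul_assoc, h1, mul_one]
  · intro hu
    have h2 : quatR4.symm (conormal n₁ x) ≠ 0 := fun h0 => by simp [h0] at h1
    refine mul_right_cancel₀ h2 ?_
    rw [hu, conormalRotation, mul_assoc, h1, mul_one]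

theorem leftMul_conormal₁ (h : IsLorentzPair n₁ n₂) (hx : x ∈ conormalPlane n₁ n₂) :
    leftMul (conormalRotation n₁ n₂ x) (conormal n₁ x) = conormal n₂ x := by
  rw [leftMul, (eq_conormalRotation_iff h hx _).1 rfl, LinearIsometryEquiv.apply_symm_apply]

/-- Conjugation exchanges the factors of `ν₂ ν̄₁`. Swapping the normals thus accounts for the
opposite orientation. -/
theorem conormalRotation_swap (h : IsLorentzPair n₁ n₂) (hx : x ∈ conormalPlane n₁ n₂) :
    conormalRotation n₂ n₁ x = -conormalRotation n₁ n₂ x := by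
  rw [← (conormalRotation_isImaginaryUnit h hx).star_eq, conormalRotation, conormalRotation,
    star_mul, star_star]

/-- The rotation is skew and preserves the normal plane, hence also its orthogonal complement. -/
theorem leftMul_mem_conormalPerp (h : IsLorentzPair n₁ n₂) (hx : x ∈ conormalPlane n₁ n₂)
    {t : E4} (ht : t ∈ conormalPerp n₁ n₂ x) :
    leftMul (conormalRotation n₁ n₂ x) t ∈ conormalPerp n₁ n₂ x := by
  have hu := conormalRotation_isImaginaryUnit h hx
  have h12 := leftMul_conormal₁ h hx
  have h21 : leftMul (conormalRotation n₁ n₂ x) (conormal n₂ x) = -conormal n₁ x := by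
    rw [← h12, hu.leftMul_leftMul]
  rw [mem_conormalPerp] at ht ⊢
  constructor
  · rw [← neg_eq_zero, ← hu.inner_leftMul_left, h12, ht.2]
  · rw [← neg_eq_zero, ← hu.inner_leftMul_left, h21, inner_neg_left, ht.1, neg_zero]

theorem exists_eq_add_leftMul (h : IsLorentzPair n₁ n₂) (hx : x ∈ conormalPlane n₁ n₂)
    {t s : E4} (ht : t ∈ conormalPerp n₁ n₂ x) (h0 : t ≠ 0) (hs : s ∈ conormalPerp n₁ n₂ x) :
    ∃ c d : ℝ, s = c • t + d • leftMul (conormalRotation n₁ n₂ x) t :=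
  have hu := conormalRotation_isImaginaryUnit h hx
  exists_eq_add_smul_of_finrank_two (finrank_conormalPerp h hx) ht
    (leftMul_mem_conormalPerp h hx ht) h0 (hu.leftMul_ne_zero h0) (hu.inner_leftMul_self t) hs

/-- The value of a 2-form on `(s, us)` is a positive multiple of its value on `(t, ut)`. -/
theorem exists_pos_apply_leftMul (h : IsLorentzPair n₁ n₂) (hx : x ∈ conormalPlane n₁ n₂)
    {t s : E4} (ht : t ∈ conormalPerp n₁ n₂ x) (ht0 : t ≠ 0) (hs : s ∈ conormalPerp n₁ n₂ x)
    (hs0 : s ≠ 0) (θ : E4 [⋀^Fin 2]→L[ℝ] ℝ) : ∃ r : ℝ, 0 < r ∧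
      θ ![s, leftMul (conormalRotation n₁ n₂ x) s] =
        r * θ ![t, leftMul (conormalRotation n₁ n₂ x) t] := by
  have hu := conormalRotation_isImaginaryUnit h hx
  obtain ⟨c, d, rfl⟩ := exists_eq_add_leftMul h hx ht ht0 hs
  -- The determinant of the change from `(t, ut)` to `(s, us)` when `s = c t + d ut`.
  refine ⟨c * c + d * d, ?_, ?_⟩
  · by_contra hn
    have hc : c = 0 := by nlinarith [mul_self_nonneg c, mul_self_nonneg d]
    have hd : d = 0 := by nlinarith [mul_self_nonneg c, mul_self_nonneg d]
    simp [hc, hd] at hs0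
  · have e : leftMul (conormalRotation n₁ n₂ x)
        (c • t + d • leftMul (conormalRotation n₁ n₂ x) t) =
        (-d) • t + c • leftMul (conormalRotation n₁ n₂ x) t := by
      rw [leftMul_add, leftMul_smul, leftMul_smul, hu.leftMul_leftMul]
      module
    rw [e, alternating_pair_combination]
    ring

end LorentzPair

namespace IsLorentzFrame

variable {w₀ w₁ w₂ n₁ n₂ : E4 × ℝ}

/-- The form `(t, s) ↦ ⟨ut, s⟩` depends continuously on the point, and at `s = c t + d ut` it equals
`d |t|²`. -/
theorem exists_isOrientation (h : IsLorentzFrame w₀ w₁ w₂ n₁ n₂) :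
    ∃ θ : E4 → E4 [⋀^Fin 2]→L[ℝ] ℝ, IsOrientation (conormalPlane n₁ n₂) θ := by
  refine ⟨fun x => rotationForm (conormalRotation n₁ n₂ x), ?_, ?_⟩
  · exact (rotationForm.continuous_of_finiteDimensional.comp
      (continuous_conormalRotation n₁ n₂)).continuousOn
  · intro x hx t ht s hs hli
    rw [h.tangentPlane_eq hx] at ht hs
    have hu := conormalRotation_isImaginaryUnit h.isLorentzPair hx
    have ht0 : t ≠ 0 := hli.ne_zero 0
    obtain ⟨c, d, rfl⟩ := exists_eq_add_leftMul h.isLorentzPair hx ht ht0 hs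
    rw [rotationForm_apply, hu.im_eq, inner_add_right, real_inner_smul_right,
      real_inner_smul_right, hu.inner_leftMul_leftMul, real_inner_comm, hu.inner_leftMul_self,
      mul_zero, zero_add]
    refine mul_ne_zero ?_ (inner_self_ne_zero.2 ht0)
    rintro rfl
    have := LinearIndependent.pair_iff.1 hli (-c) 1 (by module)
    simp at this

/-- The global parametrization supplies a nowhere zero tangent field `t`. The function `θ(t, ut)` is
continuous without zeros on the connected parameter plane, so its sign is constant; the other
tangent vectors at a point share it. -/
theorem apply_leftMul_pos_or_neg (h : IsLorentzFrame w₀ w₁ w₂ n₁ n₂)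
    {θ : E4 → E4 [⋀^Fin 2]→L[ℝ] ℝ} (hθ : IsOrientation (conormalPlane n₁ n₂) θ) :
    (∀ x ∈ conormalPlane n₁ n₂, ∀ t ∈ conormalPerp n₁ n₂ x, t ≠ 0 →
        0 < θ x ![t, leftMul (conormalRotation n₁ n₂ x) t]) ∨
      ∀ x ∈ conormalPlane n₁ n₂, ∀ t ∈ conormalPerp n₁ n₂ x, t ≠ 0 →
        θ x ![t, leftMul (conormalRotation n₁ n₂ x) t] < 0 := by
  set f := planeParam w₀ w₁ w₂ with hf
  set e : E2 := EuclideanSpace.single 0 1 with he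
  have hfc : Continuous f := h.contDiff_planeParam.continuous
  have hte : ∀ p, fderiv ℝ f p e ∈ conormalPerp n₁ n₂ (f p) ∧ fderiv ℝ f p e ≠ 0 := fun p => by
    refine ⟨?_, fun h0 => ?_⟩
    · rw [← range_fderiv_eq_conormalPerp h.isLorentzPair h.isLocalParam (Set.mem_univ p)]
      exact ⟨e, rfl⟩
    · have := h.isLocalParam.immersion p (Set.mem_univ p) (h0.trans (map_zero _).symm)
      simp [he] at this
  set F : E2 → ℝ := fun p =>
    θ (f p) ![fderiv ℝ f p e, leftMul (conormalRotation n₁ n₂ (f p)) (fderiv ℝ f p e)] with hF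
  have hFc : Continuous F := by
    have h1 : Continuous fun p => fderiv ℝ f p e :=
      (h.contDiff_planeParam.continuous_fderiv (by simp)).clm_apply continuous_const
    have h2 : Continuous fun p => leftMul (conormalRotation n₁ n₂ (f p)) (fderiv ℝ f p e) :=
      continuous_leftMul.comp (((continuous_conormalRotation n₁ n₂).comp hfc).prodMk h1)
    have h3 : Continuous fun p => θ (f p) := hθ.1.comp_continuous hfc h.planeParam_mem
    exact h3.eval (continuous_pi fun i => by fin_cases i; exacts [h1, h2])
  have hF0 : ∀ p, F p ≠ 0 := fun p => by
    obtain ⟨ht, h0⟩ := hte p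
    have hx := h.planeParam_mem p
    have hu := conormalRotation_isImaginaryUnit h.isLorentzPair hx
    refine hθ.2 _ hx _ (by rwa [h.tangentPlane_eq hx]) _
      (by rw [h.tangentPlane_eq hx]; exact leftMul_mem_conormalPerp h.isLorentzPair hx ht) ?_
    refine linearIndependent_of_ne_zero_of_inner_eq_zero (𝕜 := ℝ) (fun i => ?_) fun i j hij => ?_
    · fin_cases i
      exacts [h0, hu.leftMul_ne_zero h0]
    · fin_cases i <;> fin_cases j
      exacts [absurd rfl hij, hu.inner_leftMul_self _,
        (real_inner_comm _ _).trans (hu.inner_leftMul_self _), absurd rfl hij]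
  have hsign : (∀ p, 0 < F p) ∨ ∀ p, F p < 0 := by
    by_contra! hcon
    obtain ⟨⟨p, hp⟩, q, hq⟩ := hcon
    obtain ⟨r, hr⟩ := mem_range_of_exists_le_of_exists_ge hFc ⟨p, hp⟩ ⟨q, hq⟩
    exact hF0 r hr
  have hprop : ∀ x ∈ conormalPlane n₁ n₂, ∀ t ∈ conormalPerp n₁ n₂ x, t ≠ 0 →
      ∃ p, ∃ r : ℝ, 0 < r ∧ θ x ![t, leftMul (conormalRotation n₁ n₂ x) t] = r * F p := by
    intro x hx t ht h0
    refine ⟨planeCoord w₁ w₂ x, ?_⟩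
    obtain ⟨hs, hs0⟩ := hte (planeCoord w₁ w₂ x)
    have hp : f (planeCoord w₁ w₂ x) = x := h.planeParam_planeCoord hx
    simp only [hF]
    rw [hp] at hs ⊢
    exact exists_pos_apply_leftMul h.isLorentzPair hx hs hs0 ht h0 (θ x)
  rcases hsign with hpos | hneg
  · left
    intro x hx t ht h0
    obtain ⟨p, r, hr, e⟩ := hprop x hx t ht h0
    rw [e]
    exact mul_pos hr (hpos p)
  · right
    intro x hx t ht h0
    obtain ⟨p, r, hr, e⟩ := hprop x hx t ht h0
    rw [e]
    exact mul_neg_of_pos_of_neg hr (hneg p)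

end IsLorentzFrame

/-! ### Homogeneous coordinates of the twistor space -/

/-- The quaternion `q₁ = z₁ + z₂ 𝐣`. -/
def quatFst (z : C4) : Quaternion ℝ := quatOfPair (z 0) (z 1)

/-- The quaternion `q₂ = z₃ + z₄ 𝐣`. -/
def quatSnd (z : C4) : Quaternion ℝ := quatOfPair (z 2) (z 3)

/-- The imaginary unit `q₁⁻¹ 𝐢 q₁` of the almost hermitian structure represented by `[z]`. -/
def twistorUnit (z : C4) : Quaternion ℝ := (quatFst z)⁻¹ * quatI * quatFst z

theorem quatFst_smul (c : ℂ) (z : C4) : quatFst (c • z) = quatOfPair c 0 * quatFst z :=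
  quatOfPair_smul c _ _

theorem quatSnd_smul (c : ℂ) (z : C4) : quatSnd (c • z) = quatOfPair c 0 * quatSnd z :=
  quatOfPair_smul c _ _

theorem quatOfPair_add (a b c d : ℂ) :
    quatOfPair (a + b) (c + d) = quatOfPair a c + quatOfPair b d := by
  ext <;> simp [quatOfPair_re, quatOfPair_imI, quatOfPair_imJ, quatOfPair_imK]

theorem quatFst_add (z v : C4) : quatFst (z + v) = quatFst z + quatFst v := quatOfPair_add _ _ _ _

theorem quatSnd_add (z v : C4) : quatSnd (z + v) = quatSnd z + quatSnd v := quatOfPair_add _ _ _ _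

theorem quatOfPair_zero : quatOfPair 0 0 = 0 := rfl

theorem ext_quatFst_quatSnd {z v : C4} (h₁ : quatFst z = quatFst v) (h₂ : quatSnd z = quatSnd v) :
    z = v := by
  have key : ∀ {a b c d : ℂ}, quatOfPair a b = quatOfPair c d → a = c ∧ b = d := by
    intro a b c d h
    have h0 := congrArg (fun q : Quaternion ℝ => q.re) h
    have h1 := congrArg (fun q : Quaternion ℝ => q.imI) h
    have h2 := congrArg (fun q : Quaternion ℝ => q.imJ) h
    have h3 := congrArg (fun q : Quaternion ℝ => q.imK) h
    exact ⟨Complex.ext h0 h1, Complex.ext h2 h3⟩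
  funext i
  fin_cases i
  exacts [(key h₁).1, (key h₁).2, (key h₂).1, (key h₂).2]

theorem exists_quatFst_quatSnd (p q : Quaternion ℝ) : ∃ z : C4, quatFst z = p ∧ quatSnd z = q :=
  ⟨![⟨p.re, p.imI⟩, ⟨p.imJ, p.imK⟩, ⟨q.re, q.imI⟩, ⟨q.imJ, q.imK⟩], rfl, rfl⟩

theorem exists_eq_quatOfPair_of_commute {q : Quaternion ℝ} (h : quatI * q = q * quatI) :
    ∃ c : ℂ, q = quatOfPair c 0 := by
  refine ⟨⟨q.re, q.imI⟩, ?_⟩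
  rw [quatI_eq] at h
  have h2 := congrArg (fun q : Quaternion ℝ => q.imJ) h
  have h3 := congrArg (fun q : Quaternion ℝ => q.imK) h
  simp [quatOfPair_re, quatOfPair_imI, quatOfPair_imJ, quatOfPair_imK] at h2 h3
  ext <;> simp [quatOfPair_re, quatOfPair_imI, quatOfPair_imJ, quatOfPair_imK] <;> linarith

theorem norm_sq_quatOfPair (a b : ℂ) : ‖quatOfPair a b‖ ^ 2 = ‖a‖ ^ 2 + ‖b‖ ^ 2 := by
  rw [sq, ← Quaternion.normSq_eq_norm_mul_self, Quaternion.normSq_def', ← Complex.normSq_eq_norm_sq,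
    ← Complex.normSq_eq_norm_sq, Complex.normSq_apply, Complex.normSq_apply, quatOfPair_re,
    quatOfPair_imI, quatOfPair_imJ, quatOfPair_imK]
  ring

theorem symm_twistorVec (z : C4) : quatR4.symm (twistorVec z) = (quatFst z)⁻¹ * quatSnd z :=
  quatR4.symm_apply_apply _

theorem quatSnd_eq {z : C4} (hz : quatFst z ≠ 0) :
    quatSnd z = quatFst z * quatR4.symm (twistorVec z) := by
  rw [symm_twistorVec, mul_inv_cancel_left₀ hz]

theorem twistorStructure_eq (z : C4) : twistorStructure z = leftMul (twistorUnit z) := rfl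

theorem quatFst_mul_twistorUnit {z : C4} (hz : quatFst z ≠ 0) :
    quatFst z * twistorUnit z = quatI * quatFst z := by
  rw [twistorUnit, mul_assoc, mul_inv_cancel_left₀ hz]

theorem isImaginaryUnit_twistorUnit {z : C4} (hz : quatFst z ≠ 0) :
    IsImaginaryUnit (twistorUnit z) := by
  refine isImaginaryUnit_of_re_eq_zero ?_ ?_
  · have h : ∀ a b : Quaternion ℝ, (a * b).re = (b * a).re := fun a b => by simp; ring
    rw [twistorUnit, h, mul_inv_cancel_left₀ hz]
    rfl
  · have hi : ‖quatI‖ = 1 := by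
      have h1 : ‖quatI‖ * ‖quatI‖ = 1 := by rw [← norm_mul, quatI_mul_quatI, norm_neg, norm_one]
      nlinarith [norm_nonneg quatI]
    rw [twistorUnit, norm_mul, norm_mul, norm_inv, hi, mul_one,
      inv_mul_cancel₀ (norm_ne_zero_iff.2 hz)]

/-- Every imaginary unit is conjugate to `𝐢`. -/
theorem IsImaginaryUnit.exists_twistorUnit_eq {u : Quaternion ℝ} (hu : IsImaginaryUnit u)
    (x : E4) : ∃ z : C4, quatFst z ≠ 0 ∧ twistorUnit z = u ∧ twistorVec z = x := by
  obtain ⟨q, hq, hqu⟩ : ∃ q : Quaternion ℝ, q ≠ 0 ∧ quatI * q = q * u := by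
    -- The general solution is `q = 1 - 𝐢u`, since `𝐢q` and `qu` both equal `𝐢 + u`. It vanishes
    -- only for `u = -𝐢`, where `𝐣` serves instead.
    by_cases h : u = -quatI
    · refine ⟨quatOfPair 0 1, fun h0 => ?_, ?_⟩
      · exact one_ne_zero (α := ℝ) (congrArg (fun q : Quaternion ℝ => q.imJ) h0)
      · rw [h, quatI_eq]
        ext <;> simp [quatOfPair_re, quatOfPair_imI, quatOfPair_imJ, quatOfPair_imK]
    · refine ⟨1 - quatI * u, fun h0 => h ?_, ?_⟩
      · have h1 : quatI * (quatI * u) = quatI := by rw [← sub_eq_zero.1 h0, mul_one]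
        rw [← mul_assoc, quatI_mul_quatI, neg_one_mul] at h1
        rw [← h1, neg_neg]
      · rw [mul_sub, sub_mul, mul_assoc quatI u u, hu.mul_self, ← mul_assoc, quatI_mul_quatI]
        simp only [mul_one, one_mul, neg_one_mul, mul_neg, sub_neg_eq_add]
        rw [add_comm]
  obtain ⟨z, h₁, h₂⟩ := exists_quatFst_quatSnd q (q * quatR4.symm x)
  refine ⟨z, by rwa [h₁], ?_, ?_⟩
  · rw [twistorUnit, h₁, mul_assoc, hqu, inv_mul_cancel_left₀ hq]
  · apply quatR4.symm.injective
    rw [symm_twistorVec, h₁, h₂, inv_mul_cancel_left₀ hq]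

/-- A point of the twistor space is determined by its projection and its complex structure. -/
theorem exists_smul_eq_of_twistorUnit_eq {z v : C4} (hz : quatFst z ≠ 0) (hv : quatFst v ≠ 0)
    (hu : twistorUnit z = twistorUnit v) (hx : twistorVec z = twistorVec v) :
    ∃ c : ℂ, c • z = v := by
  -- Equal units make the quotient of the first coordinates commute with `𝐢`, hence complex.
  obtain ⟨c, hc⟩ : ∃ c : ℂ, quatFst v * (quatFst z)⁻¹ = quatOfPair c 0 := by
    refine exists_eq_quatOfPair_of_commute ?_
    rw [← mul_assoc, ← quatFst_mul_twistorUnit hv, ← hu, twistorUnit]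
    simp only [mul_assoc]
    rw [mul_inv_cancel₀ hz, mul_one]
  have h1 : quatOfPair c 0 * quatFst z = quatFst v := by
    rw [← hc, mul_assoc, inv_mul_cancel₀ hz, mul_one]
  refine ⟨c, ext_quatFst_quatSnd ?_ ?_⟩
  · rw [quatFst_smul, h1]
  · rw [quatSnd_smul, quatSnd_eq hz, quatSnd_eq hv, ← hx, ← mul_assoc, h1]

theorem twistorUnit_smul {c : ℂ} (hc : c ≠ 0) (z : C4) : twistorUnit (c • z) = twistorUnit z := by
  rw [twistorUnit, twistorUnit, quatFst_smul, mul_inv_rev]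
  simp only [mul_assoc]
  rw [← mul_assoc quatI, quatI_comm, mul_assoc, inv_mul_cancel_left₀ (quatOfPair_ne_zero hc)]

/-- Membership in `Ω` in terms of the projection. -/
theorem mem_twistorDomain_iff {ℓ : ℙ ℂ C4} : ℓ ∈ twistorDomain ↔
    quatFst ℓ.rep ≠ 0 ∧ twistorVec ℓ.rep ∈ unitBall4 := by
  have h0 : ℓ ∈ twistorDomain ↔ ‖quatSnd ℓ.rep‖ ^ 2 < ‖quatFst ℓ.rep‖ ^ 2 := by
    rw [quatSnd, quatFst, norm_sq_quatOfPair, norm_sq_quatOfPair]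
    rfl
  rw [h0, sq_lt_sq₀ (norm_nonneg _) (norm_nonneg _)]
  by_cases hz : quatFst ℓ.rep = 0
  · simp only [hz, norm_zero, ne_eq, not_true_eq_false, false_and, iff_false, not_lt]
    exact norm_nonneg _
  · have hp : 0 < ‖quatFst ℓ.rep‖ := norm_pos_iff.2 hz
    rw [quatSnd_eq hz, norm_mul, LinearIsometryEquiv.norm_map]
    rw [mul_lt_iff_lt_one_right hp]
    exact ⟨fun h => ⟨hz, h⟩, fun h => h.2⟩

theorem exists_mk_rep {z : C4} (hz : quatFst z ≠ 0) : ∃ ℓ : ℙ ℂ C4, ∃ c : ℂ, c ≠ 0 ∧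
    ℓ.rep = c • z := by
  have hz0 : z ≠ 0 := by
    rintro rfl
    exact hz quatOfPair_zero
  obtain ⟨a, ha⟩ := Projectivization.exists_smul_eq_mk_rep ℂ z hz0
  exact ⟨_, a, a.ne_zero, ha.symm⟩

theorem IsImaginaryUnit.exists_twistor {u : Quaternion ℝ} (hu : IsImaginaryUnit u)
    {x : E4} (hx : x ∈ unitBall4) :
    ∃ ℓ ∈ twistorDomain, twistorUnit ℓ.rep = u ∧ twistorProj ℓ = x := by
  obtain ⟨z, hz, hzu, hzx⟩ := hu.exists_twistorUnit_eq x
  obtain ⟨ℓ, c, hc, hℓ⟩ := exists_mk_rep hz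
  have hv : twistorVec ℓ.rep = x := by rw [hℓ, twistorVec_smul c hc, hzx]
  refine ⟨ℓ, mem_twistorDomain_iff.2 ⟨?_, by rwa [hv]⟩, ?_, hv⟩
  · rw [hℓ, quatFst_smul]
    exact mul_ne_zero (quatOfPair_ne_zero hc) hz
  · rw [hℓ, twistorUnit_smul hc, hzu]

theorem twistor_ext {ℓ ℓ' : ℙ ℂ C4} (h : ℓ ∈ twistorDomain) (h' : ℓ' ∈ twistorDomain)
    (hu : twistorUnit ℓ.rep = twistorUnit ℓ'.rep) (hx : twistorProj ℓ = twistorProj ℓ') :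
    ℓ = ℓ' := by
  obtain ⟨c, hc⟩ := exists_smul_eq_of_twistorUnit_eq (mem_twistorDomain_iff.1 h).1
    (mem_twistorDomain_iff.1 h').1 hu hx
  rw [← ℓ.mk_rep, ← ℓ'.mk_rep, eq_comm, Projectivization.mk_eq_mk_iff']
  exact ⟨c, hc⟩

/-! ### The complex lines -/

/-- The first component of the action of the Lorentz vector `n` on `ℍ²`. -/
def cliffordFst (n : E4 × ℝ) (z : C4) : Quaternion ℝ :=
  n.2 • quatFst z - quatSnd z * star (quatR4.symm n.1)

/-- The second component of the action of the Lorentz vector `n` on `ℍ²`. -/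
def cliffordSnd (n : E4 × ℝ) (z : C4) : Quaternion ℝ :=
  quatFst z * quatR4.symm n.1 - n.2 • quatSnd z

theorem cliffordFst_add (n : E4 × ℝ) (z v : C4) :
    cliffordFst n (z + v) = cliffordFst n z + cliffordFst n v := by
  simp only [cliffordFst, quatFst_add, quatSnd_add, add_mul, smul_add]
  abel

theorem cliffordSnd_add (n : E4 × ℝ) (z v : C4) :
    cliffordSnd n (z + v) = cliffordSnd n z + cliffordSnd n v := by
  simp only [cliffordSnd, quatFst_add, quatSnd_add, add_mul, smul_add]
  abel

theorem cliffordFst_smul (n : E4 × ℝ) (c : ℂ) (z : C4) :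
    cliffordFst n (c • z) = quatOfPair c 0 * cliffordFst n z := by
  simp only [cliffordFst, quatFst_smul, quatSnd_smul, mul_sub, mul_assoc, mul_smul_comm]

theorem cliffordSnd_smul (n : E4 × ℝ) (c : ℂ) (z : C4) :
    cliffordSnd n (c • z) = quatOfPair c 0 * cliffordSnd n z := by
  simp only [cliffordSnd, quatFst_smul, quatSnd_smul, mul_sub, mul_assoc, mul_smul_comm]

/-- The complex subspace of `ℍ² = ℂ⁴` defined by two Lorentz vectors. -/
def twistorSubspace (n₁ n₂ : E4 × ℝ) : Submodule ℂ C4 where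
  carrier := {z | quatI * cliffordFst n₁ z = cliffordFst n₂ z ∧
    quatI * cliffordSnd n₁ z = cliffordSnd n₂ z}
  add_mem' := by
    rintro z v ⟨h₁, h₂⟩ ⟨h₃, h₄⟩
    refine ⟨?_, ?_⟩
    · rw [cliffordFst_add, cliffordFst_add, mul_add, h₁, h₃]
    · rw [cliffordSnd_add, cliffordSnd_add, mul_add, h₂, h₄]
  zero_mem' := by
    have h₁ : quatFst 0 = 0 := quatOfPair_zero
    have h₂ : quatSnd 0 = 0 := quatOfPair_zero
    refine ⟨?_, ?_⟩ <;>
      simp only [cliffordFst, cliffordSnd, h₁, h₂, smul_zero, zero_mul, sub_self, mul_zero]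
  smul_mem' := by
    rintro c z ⟨h₁, h₂⟩
    refine ⟨?_, ?_⟩
    · rw [cliffordFst_smul, cliffordFst_smul, ← mul_assoc, quatI_comm, mul_assoc, h₁]
    · rw [cliffordSnd_smul, cliffordSnd_smul, ← mul_assoc, quatI_comm, mul_assoc, h₂]

theorem mem_twistorSubspace {n₁ n₂ : E4 × ℝ} {z : C4} : z ∈ twistorSubspace n₁ n₂ ↔
    quatI * cliffordFst n₁ z = cliffordFst n₂ z ∧ quatI * cliffordSnd n₁ z = cliffordSnd n₂ z :=
  Iff.rfl

/-- By `q₂ = q₁ x`, the conormal times `q₁` is linear in the homogeneous coordinates. -/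
theorem cliffordSnd_eq (n : E4 × ℝ) {z : C4} (hz : quatFst z ≠ 0) :
    cliffordSnd n z = quatFst z * quatR4.symm (conormal n (twistorVec z)) := by
  rw [cliffordSnd, quatSnd_eq hz, conormal, map_sub, map_smul, mul_sub, mul_smul_comm]

/-- The identity `a x̄ + x ā = 2⟨a, x⟩` isolates the defect of the equation of the plane as a real
number. -/
theorem cliffordFst_eq (n : E4 × ℝ) {z : C4} (hz : quatFst z ≠ 0) :
    cliffordFst n z = quatFst z *
      (quatR4.symm (conormal n (twistorVec z)) * star (quatR4.symm (twistorVec z)) -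
        ((2 * inner ℝ n.1 (twistorVec z) - n.2 * (1 + ‖twistorVec z‖ ^ 2) : ℝ) :
          Quaternion ℝ)) := by
  rw [cliffordFst, quatSnd_eq hz, mul_assoc, ← inner_quatR4_symm, conormal, map_sub, map_smul,
    ← quatR4.symm.norm_map (twistorVec z)]
  generalize quatR4.symm n.1 = a
  generalize quatR4.symm (twistorVec z) = x
  rw [show n.2 • quatFst z = quatFst z * (n.2 : Quaternion ℝ) by
    rw [Quaternion.mul_coe_eq_smul], ← mul_sub]
  congr 1
  rw [sq, ← Quaternion.normSq_eq_norm_mul_self, Quaternion.inner_def, Quaternion.normSq_def']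
  generalize hr : 2 * (a * star x).re -
    n.2 * (1 + (x.re ^ 2 + x.imI ^ 2 + x.imJ ^ 2 + x.imK ^ 2)) = r
  simp at hr
  ext <;> simp
  · linear_combination -hr
  all_goals ring

/-- The second linear equation says that the unit `u` of `[z]` carries `ν₁` to `ν₂`. Subtracting it,
multiplied by `x̄`, from the first leaves `u r₁ = r₂` for the real defects; as `u` is imaginary,
both vanish, which places the projection on the plane. -/
theorem IsLorentzPair.mem_twistorSubspace_iff {n₁ n₂ : E4 × ℝ} (h : IsLorentzPair n₁ n₂) {z : C4}
    (hz : quatFst z ≠ 0) (hball : twistorVec z ∈ unitBall4) : z ∈ twistorSubspace n₁ n₂ ↔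
      twistorVec z ∈ conormalPlane n₁ n₂ ∧
        twistorUnit z = conormalRotation n₁ n₂ (twistorVec z) := by
  have hu := isImaginaryUnit_twistorUnit hz
  have key : ∀ a b : Quaternion ℝ, quatI * (quatFst z * a) = quatFst z * b ↔
      twistorUnit z * a = b := fun a b => by
    rw [← mul_assoc, ← quatFst_mul_twistorUnit hz, mul_assoc]
    exact mul_right_inj' hz
  have hmem : twistorVec z ∈ conormalPlane n₁ n₂ ↔
      2 * inner ℝ n₁.1 (twistorVec z) - n₁.2 * (1 + ‖twistorVec z‖ ^ 2) = 0 ∧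
      2 * inner ℝ n₂.1 (twistorVec z) - n₂.2 * (1 + ‖twistorVec z‖ ^ 2) = 0 := by
    rw [sub_eq_zero, sub_eq_zero, ← lorentz_hypStereo_eq_zero_iff hball,
      ← lorentz_hypStereo_eq_zero_iff hball]
    exact and_iff_right hball
  rw [mem_twistorSubspace, cliffordSnd_eq n₁ hz, cliffordSnd_eq n₂ hz, cliffordFst_eq n₁ hz,
    cliffordFst_eq n₂ hz, key, key]
  constructor
  · rintro ⟨h₁, h₂⟩
    have hx : twistorVec z ∈ conormalPlane n₁ n₂ := by
      rw [hmem]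
      rw [mul_sub, ← mul_assoc, h₂, sub_right_inj] at h₁
      have hb := congrArg (fun q : Quaternion ℝ => q.re) h₁
      simp only [Quaternion.re_mul, hu.re_eq, Quaternion.re_coe, Quaternion.imI_coe,
        Quaternion.imJ_coe, Quaternion.imK_coe, mul_zero, zero_mul, sub_zero] at hb
      rw [← hb, Quaternion.coe_zero, mul_eq_zero, or_iff_right hu.ne_zero] at h₁
      exact ⟨Quaternion.coe_injective (h₁.trans Quaternion.coe_zero.symm), hb.symm⟩
    exact ⟨hx, (eq_conormalRotation_iff h hx _).2 h₂⟩
  · rintro ⟨hx, hrot⟩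
    have h₂ := (eq_conormalRotation_iff h hx _).1 hrot
    refine ⟨?_, h₂⟩
    rw [(hmem.1 hx).1, (hmem.1 hx).2, Quaternion.coe_zero, sub_zero, sub_zero, ← mul_assoc, h₂]

/-! ### The Legendrian property -/

/-- The quaternionic hermitian form of signature `(1, 1)`. -/
def quatHermitian (p₁ p₂ q₁ q₂ : Quaternion ℝ) : Quaternion ℝ := p₁ * star q₁ - p₂ * star q₂

/-- The `𝐣`-part of the hermitian form is `-β`, and a quaternion commuting with `𝐢` has none. -/
theorem contactForm_eq_zero_of_commute {z v : C4}
    (h : quatI * quatHermitian (quatFst z) (quatSnd z) (quatFst v) (quatSnd v) =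
      quatHermitian (quatFst z) (quatSnd z) (quatFst v) (quatSnd v) * quatI) :
    contactForm z v = 0 := by
  obtain ⟨c, hc⟩ := exists_eq_quatOfPair_of_commute h
  have h2 := congrArg (fun q : Quaternion ℝ => q.imJ) hc
  have h3 := congrArg (fun q : Quaternion ℝ => q.imK) hc
  simp [quatHermitian, quatFst, quatSnd, quatOfPair_re, quatOfPair_imI, quatOfPair_imJ,
    quatOfPair_imK] at h2 h3
  apply Complex.ext
  · simp [contactForm]
    linarith
  · simp [contactForm]
    linarith

/-- The mixed terms cancel and the others carry the factor `n.2² - |n.1|²`. -/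
theorem quatHermitian_clifford (n : E4 × ℝ) (z v : C4) :
    quatHermitian (cliffordFst n z) (cliffordSnd n z) (cliffordFst n v) (cliffordSnd n v) =
      -(lorentz n n • quatHermitian (quatFst z) (quatSnd z) (quatFst v) (quatSnd v)) := by
  rw [lorentz, ← inner_quatR4_symm, Quaternion.inner_self]
  simp only [cliffordFst, cliffordSnd, quatHermitian]
  generalize quatR4.symm n.1 = a
  generalize quatFst z = p₁
  generalize quatSnd z = p₂
  generalize quatFst v = q₁
  generalize quatSnd v = q₂
  have e₁ : ∀ q : Quaternion ℝ, a * (star a * q) = Quaternion.normSq a • q := fun q => by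
    rw [← mul_assoc, Quaternion.self_mul_star, Quaternion.coe_mul_eq_smul]
  have e₂ : ∀ q : Quaternion ℝ, star a * (a * q) = Quaternion.normSq a • q := fun q => by
    rw [← mul_assoc, Quaternion.star_mul_self, Quaternion.coe_mul_eq_smul]
  simp only [star_sub, star_mul, Quaternion.star_smul, star_star, sub_mul, mul_sub, mul_assoc,
    smul_mul_assoc, mul_smul_comm, e₁, e₂]
  module

/-- Both unit vectors send `H` to `-H`. On the subspace `n₂` acts as `𝐢` after `n₁`, whence `𝐢 H 𝐢̄
= H`. -/
theorem IsLorentzPair.isLegendrianSubspace {n₁ n₂ : E4 × ℝ} (h : IsLorentzPair n₁ n₂) :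
    IsLegendrianSubspace (twistorSubspace n₁ n₂) := by
  rintro z ⟨hz₁, hz₂⟩ v ⟨hv₁, hv₂⟩
  apply contactForm_eq_zero_of_commute
  have h₁ := quatHermitian_clifford n₁ z v
  have h₂ := quatHermitian_clifford n₂ z v
  set H := quatHermitian (quatFst z) (quatSnd z) (quatFst v) (quatSnd v) with hH
  rw [h.n₂₂, one_smul, ← hz₁, ← hz₂, ← hv₁, ← hv₂] at h₂
  rw [h.n₁₁, one_smul] at h₁
  have h₃ : quatI * H * star quatI = H := by
    have e : ∀ p₁ p₂ q₁ q₂, quatHermitian (quatI * p₁) (quatI * p₂) (quatI * q₁) (quatI * q₂) =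
        quatI * quatHermitian p₁ p₂ q₁ q₂ * star quatI := fun p₁ p₂ q₁ q₂ => by
      simp only [quatHermitian, star_mul, mul_sub, sub_mul, mul_assoc]
    rwa [e, h₁, mul_neg, neg_mul, neg_inj] at h₂
  rw [isImaginaryUnit_quatI.star_eq] at h₃
  calc quatI * H = quatI * H * -quatI * quatI := by
        rw [mul_assoc _ (-quatI), neg_mul, quatI_mul_quatI, neg_neg, mul_one]
    _ = H * quatI := by rw [h₃]

/-- The contact form as a bilinear form. -/
def contactBilin : LinearMap.BilinForm ℂ C4 :=
  LinearMap.mk₂ ℂ contactForm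
    (fun x y z => by simp only [contactForm, Pi.add_apply]; ring)
    (fun c x y => by simp only [contactForm, Pi.smul_apply, smul_eq_mul]; ring)
    (fun x y z => by simp only [contactForm, Pi.add_apply]; ring)
    (fun c x y => by simp only [contactForm, Pi.smul_apply, smul_eq_mul]; ring)

theorem contactBilin_isRefl : contactBilin.IsRefl := fun x y h => by
  change contactForm y x = 0
  have h' : contactForm x y = 0 := h
  rw [← neg_eq_zero, ← h', contactForm, contactForm]
  ring

theorem contactBilin_nondegenerate : contactBilin.Nondegenerate := by
  refine (LinearMap.IsRefl.nondegenerate_iff_separatingLeft contactBilin_isRefl).2 fun x hx => ?_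
  have h : ∀ v, contactForm x v = 0 := hx
  have h0 := h (Pi.single 0 1)
  have h1 := h (Pi.single 1 1)
  have h2 := h (Pi.single 2 1)
  have h3 := h (Pi.single 3 1)
  simp [contactForm] at h0 h1 h2 h3
  funext i
  fin_cases i
  exacts [h1, h0, h3, h2]

/-- An isotropic subspace lies in its complement, and the contact form is nondegenerate on `ℂ⁴`. -/
theorem IsLegendrianSubspace.finrank_le {L : Submodule ℂ C4} (hL : IsLegendrianSubspace L) :
    Module.finrank ℂ L ≤ 2 := by
  have h1 : L ≤ contactBilin.orthogonal L := fun v hv z hz => hL z hz v hv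
  have h2 := Submodule.finrank_mono h1
  rw [LinearMap.BilinForm.finrank_orthogonal contactBilin_nondegenerate,
    Module.finrank_fin_fun] at h2
  omega

/-- Two points of a Lorentz plane give a basis of its twistor subspace. -/
theorem IsLorentzPair.finrank_twistorSubspace {n₁ n₂ : E4 × ℝ} (h : IsLorentzPair n₁ n₂)
    (hnt : (conormalPlane n₁ n₂).Nontrivial) :
    Module.finrank ℂ (twistorSubspace n₁ n₂) = 2 := by
  refine le_antisymm h.isLegendrianSubspace.finrank_le ?_
  obtain ⟨x, hx, y, hy, hxy⟩ := hnt
  have lift : ∀ x ∈ conormalPlane n₁ n₂, ∃ z ∈ twistorSubspace n₁ n₂, quatFst z ≠ 0 ∧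
      twistorVec z = x := by
    intro x hx
    obtain ⟨z, hz, hu, rfl⟩ := (conormalRotation_isImaginaryUnit h hx).exists_twistorUnit_eq x
    exact ⟨z, (h.mem_twistorSubspace_iff hz hx.1).2 ⟨hx, hu⟩, hz, rfl⟩
  obtain ⟨z, hz, hz0, rfl⟩ := lift x hx
  obtain ⟨v, hv, hv0, rfl⟩ := lift y hy
  have hli : LinearIndependent ℂ ![z, v] := by
    -- Proportional lifts would project to the same point.
    refine LinearIndependent.pair_iff' (fun h0 => hz0 (by rw [h0]; exact quatOfPair_zero)) |>.2 ?_
    rintro c rfl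
    by_cases hc : c = 0
    · subst hc
      rw [zero_smul] at hv0
      exact hv0 quatOfPair_zero
    · exact hxy (twistorVec_smul c hc z).symm
  calc 2 = Module.finrank ℂ (Submodule.span ℂ (Set.range ![z, v])) := by
        rw [finrank_span_eq_card hli]; simp
    _ ≤ _ := Submodule.finrank_mono <| Submodule.span_le.2 <| by
        rintro _ ⟨i, rfl⟩
        fin_cases i
        exacts [hz, hv]

/-! ### The twistor lift -/

namespace IsLorentzFrame

variable {w₀ w₁ w₂ n₁ n₂ : E4 × ℝ}

theorem conormalPlane_nontrivial (h : IsLorentzFrame w₀ w₁ w₂ n₁ n₂) :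
    (conormalPlane n₁ n₂).Nontrivial :=
  ⟨_, h.planeParam_mem 0, _, h.planeParam_mem (EuclideanSpace.single 0 1), fun e => by
    have := congrArg (fun p : E2 => p 0) 
      (Function.LeftInverse.injective h.planeCoord_planeParam e)
    simp at this⟩

end IsLorentzFrame

section Lift

variable {n₁ n₂ : E4 × ℝ} {θ : E4 → E4 [⋀^Fin 2]→L[ℝ] ℝ}

theorem exists_mem_conormalPerp_ne_zero (h : IsLorentzPair n₁ n₂) {x : E4}
    (hx : x ∈ conormalPlane n₁ n₂) : ∃ t ∈ conormalPerp n₁ n₂ x, t ≠ 0 := by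
  refine (Submodule.ne_bot_iff _).1 fun h0 => ?_
  have := finrank_conormalPerp h hx
  rw [h0, finrank_bot] at this
  omega

/-- For a tangent `t ≠ 0`, the vector `Jt` is tangent, orthogonal to `t` and of the same length, so
it is `±ut`; positivity selects the plus sign, and one vector determines the unit. -/
theorem mem_twistorLift_iff (h : IsLorentzPair n₁ n₂)
    (htan : ∀ x ∈ conormalPlane n₁ n₂,
      tangentPlane (conormalPlane n₁ n₂) x = conormalPerp n₁ n₂ x)
    (hpos : ∀ x ∈ conormalPlane n₁ n₂, ∀ t ∈ conormalPerp n₁ n₂ x, t ≠ 0 →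
      0 < θ x ![t, leftMul (conormalRotation n₁ n₂ x) t]) {ℓ : ℙ ℂ C4} :
    ℓ ∈ twistorLift (conormalPlane n₁ n₂) θ ↔ ℓ ∈ twistorDomain ∧
      twistorProj ℓ ∈ conormalPlane n₁ n₂ ∧
      twistorUnit ℓ.rep = conormalRotation n₁ n₂ (twistorProj ℓ) := by
  refine and_congr_right fun hΩ => and_congr_right fun hx => ?_
  rw [htan _ hx, twistorJ, twistorStructure_eq]
  have hu := isImaginaryUnit_twistorUnit (mem_twistorDomain_iff.1 hΩ).1
  have hr := conormalRotation_isImaginaryUnit h hx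
  constructor
  · intro hJ
    obtain ⟨t, ht, h0⟩ := exists_mem_conormalPerp_ne_zero h hx
    obtain ⟨hmem, hp⟩ := hJ t ht
    have hp := hp h0
    have hq := hpos _ hx t ht h0
    obtain ⟨c, d, hcd⟩ := exists_eq_add_leftMul h hx ht h0 hmem
    have htt : 0 < inner ℝ t t := real_inner_self_pos.2 h0
    have hc : c = 0 := by
      have e := hu.inner_leftMul_self t
      rw [hcd, inner_add_right, real_inner_smul_right, real_inner_smul_right,
        hr.inner_leftMul_self, mul_zero, add_zero] at e
      exact (mul_eq_zero.1 e).resolve_right htt.ne'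
    rw [hc, zero_smul, zero_add] at hcd
    have hd2 : d * d = 1 := by
      have e := hu.inner_leftMul_leftMul t t
      rw [hcd, real_inner_smul_left, real_inner_smul_right, hr.inner_leftMul_leftMul,
        ← mul_assoc] at e
      exact mul_right_cancel₀ htt.ne' (e.trans (one_mul _).symm)
    have hd : 0 < d := by
      have e := alternating_pair_combination (θ (twistorProj ℓ)) t
        (leftMul (conormalRotation n₁ n₂ (twistorProj ℓ)) t) 1 0 0 d
      simp only [one_smul, zero_smul, add_zero, zero_add, one_mul, zero_mul, sub_zero] at e
      rw [hcd, e] at hp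
      exact pos_of_mul_pos_left hp hq.le
    have hd1 : d = 1 := by nlinarith
    rw [hd1, one_smul] at hcd
    exact leftMul_right_cancel h0 hcd
  · intro e t ht
    rw [e]
    exact ⟨leftMul_mem_conormalPerp h hx ht, hpos _ hx t ht⟩

theorem projLine_iff {L : Submodule ℂ C4} {ℓ : ℙ ℂ C4} : ℓ ∈ projLine L ↔ ℓ.rep ∈ L := by
  change ℓ.submodule ≤ L ↔ _
  rw [Projectivization.submodule_eq, Submodule.span_singleton_le_iff_mem]

theorem twistorLift_eq_and_bijOn (h : IsLorentzPair n₁ n₂)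
    (htan : ∀ x ∈ conormalPlane n₁ n₂,
      tangentPlane (conormalPlane n₁ n₂) x = conormalPerp n₁ n₂ x)
    (hnt : (conormalPlane n₁ n₂).Nontrivial)
    (hpos : ∀ x ∈ conormalPlane n₁ n₂, ∀ t ∈ conormalPerp n₁ n₂ x, t ≠ 0 →
      0 < θ x ![t, leftMul (conormalRotation n₁ n₂ x) t]) :
    Set.BijOn twistorProj (twistorLift (conormalPlane n₁ n₂) θ) (conormalPlane n₁ n₂) ∧
      ∃ L : Submodule ℂ C4, Module.finrank ℂ L = 2 ∧ IsLegendrianSubspace L ∧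
        twistorLift (conormalPlane n₁ n₂) θ = twistorDomain ∩ projLine L := by
  refine ⟨⟨fun ℓ hℓ => hℓ.2.1, ?_, ?_⟩, twistorSubspace n₁ n₂, h.finrank_twistorSubspace hnt,
    h.isLegendrianSubspace, ?_⟩
  · intro ℓ hℓ ℓ' hℓ' e
    rw [mem_twistorLift_iff h htan hpos] at hℓ hℓ'
    exact twistor_ext hℓ.1 hℓ'.1 (by rw [hℓ.2.2, hℓ'.2.2, e]) e
  · intro x hx
    obtain ⟨ℓ, hℓ, hu, rfl⟩ := (conormalRotation_isImaginaryUnit h hx).exists_twistor hx.1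
    exact ⟨ℓ, (mem_twistorLift_iff h htan hpos).2 ⟨hℓ, hx, hu⟩, rfl⟩
  · ext ℓ
    rw [mem_twistorLift_iff h htan hpos, Set.mem_inter_iff, projLine_iff]
    refine and_congr_right fun hΩ => ?_
    obtain ⟨hz, hball⟩ := mem_twistorDomain_iff.1 hΩ
    exact (h.mem_twistorSubspace_iff hz hball).symm

end Lift

/-! ### Assembly of the proposition -/

theorem IsHyperbolicPlane.exists_isLorentzFrame {Λ : Set E4} (hΛ : IsHyperbolicPlane 2 Λ) :
    ∃ w₀ w₁ w₂ n₁ n₂, IsLorentzFrame w₀ w₁ w₂ n₁ n₂ ∧ Λ = conormalPlane n₁ n₂ := by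
  obtain ⟨W, hW, ht, rfl⟩ := hΛ
  obtain ⟨w₀, w₁, w₂, n₁, n₂, h, hmem⟩ := _root_.exists_isLorentzFrame W hW ht
  refine ⟨w₀, w₁, w₂, n₁, n₂, h, ?_⟩
  ext x
  exact and_congr_right fun _ => hmem _

end

theorem proposition3p1 (Λ : Set E4) (hΛ : IsHyperbolicPlane 2 Λ) :
    IsEmbeddedSurface Λ ∧ IsTotallyGeodesic Λ ∧
      (∃ θ : E4 → E4 [⋀^Fin 2]→L[ℝ] ℝ, IsOrientation Λ θ) ∧
      ∀ θ : E4 → E4 [⋀^Fin 2]→L[ℝ] ℝ, IsOrientation Λ θ →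
        IsSuperminimal 1 Λ θ ∧ IsSuperminimal (-1) Λ θ ∧
        Set.BijOn twistorProj (twistorLift Λ θ) Λ ∧
        ∃ L : Submodule ℂ C4, Module.finrank ℂ L = 2 ∧ IsLegendrianSubspace L ∧
          twistorLift Λ θ = twistorDomain ∩ projLine L := by
  obtain ⟨w₀, w₁, w₂, n₁, n₂, h, rfl⟩ := hΛ.exists_isLorentzFrame
  refine ⟨h.isEmbeddedSurface, isTotallyGeodesic_conormalPlane h.isLorentzPair,
    h.exists_isOrientation, fun θ hθ => ⟨h.isSuperminimal 1 θ, h.isSuperminimal (-1) θ, ?_⟩⟩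
  rcases h.apply_leftMul_pos_or_neg hθ with hpos | hneg
  · exact twistorLift_eq_and_bijOn h.isLorentzPair (fun x hx => h.tangentPlane_eq hx)
      h.conormalPlane_nontrivial hpos
  -- When the orientation disagrees with the rotation, the pair `n₂, n₁` describes the same plane
  -- with the opposite rotation, so the positive case applies to it.
  · have hperp : ∀ x, conormalPerp n₂ n₁ x = conormalPerp n₁ n₂ x := fun x => by
      ext v
      rw [mem_conormalPerp, mem_conormalPerp, and_comm]
    have hneg' : ∀ x ∈ conormalPlane n₁ n₂, ∀ t ∈ conormalPerp n₂ n₁ x, t ≠ 0 →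
        0 < θ x ![t, leftMul (conormalRotation n₂ n₁ x) t] := by
      intro x hx t ht h0
      rw [hperp] at ht
      have e := alternating_pair_combination (θ x) t
        (leftMul (conormalRotation n₁ n₂ x) t) 1 0 0 (-1)
      simp only [one_smul, zero_smul, add_zero, zero_add, neg_smul, mul_zero, sub_zero,
        one_mul] at e
      rw [conormalRotation_swap h.isLorentzPair hx, neg_leftMul, e]
      linarith [hneg x hx t ht h0]
    have htan : ∀ x ∈ conormalPlane n₁ n₂,
        tangentPlane (conormalPlane n₁ n₂) x = conormalPerp n₂ n₁ x := fun x hx => by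
      rw [h.tangentPlane_eq hx, hperp]
    have hnt := h.conormalPlane_nontrivial
    rw [conormalPlane_swap n₁ n₂] at hneg' htan hnt ⊢
    exact twistorLift_eq_and_bijOn h.isLorentzPair.swap htan hnt hneg'
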